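/- **Proposition 1.5.** Let $\mathbb S^2\subset\mathbb R^3$ be the unit sphere with its Riemannian distance $d_{S^2}(x,y)=\arccos\langle x,y\rangle$, let $H^2=\{x\in\mathbb S^2: x_3\ge 0\}$ be the closed hemisphere and $S^1=\{x\in\mathbb S^2 : x_3=0\}$ its boundary circle, both with the restricted (equivalently, intrinsic length) metric. Let $\mathcal P_1(S^1)$ be the Wasserstein-$1$-space over $S^1$: the set of Borel probability measures on $S^1$ (at finite distance from Dirac measures, which is automatic here) with $$d_W(\mu,\nu)=\inf_{K}\int_{S^1\times S^1} d(x,y)\,\mathrm dK(x,y),$$ the infimum being over all couplings $K$ of $\mu$ and $\nu$, i.e. measures on $S^1\times S^1$ with marginals $\mu$ and $\nu$. For $P\in H^2\setminus S^1$ let $d_P:S^1\to\mathbb R$, $d_P(Q)=d_{S^2}(P,Q)$, let $d_P''$ be its second derivative with respect to arc length on $S^1$, and let $k_P=\cos\big(d_{S^2}(P,S^1)\big)$, where $d_{S^2}(P,S^1)=\inf_{Q\in S^1}d_{S^2}(P,Q)$. Then there exists an isometric embedding $\iota:H^2\to\mathcal P_1(S^1)$, that is, a map with $d_W(\iota(P),\iota(P'))=d_{S^2}(P,P')$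 for all $P,P'\in H^2$, such that $\iota(P)=\delta_P$ for all $P\in S^1$. Moreover $\iota$ can be chosen so that for every $P\in H^2\setminus S^1$ the measure $\iota(P)$ has density $$\tfrac12\,(d_P'')^+ +\frac{1-k_P}{2\pi}$$ with respect to the one-dimensional Hausdorff measure $\mathcal H^1_{S^1}$ on $S^1$. -/

import Mathlib

open MeasureTheory

noncomputable section

/-- The set of couplings of `μ` and `ν`. -/
def couplings {X : Type*} [MeasurableSpace X] (μ ν : Measure X) : Set (Measure (X × X)) :=
  {K | K.map Prod.fst = μ ∧ K.map Prod.snd = ν}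

/-- The Wasserstein-1-distance, with values in `[0, ∞]`. The space is separable, so the product
σ-algebra on `X × X` is the Borel one and all Borel measures are separably supported. -/
def wassersteinDist {X : Type*} [MetricSpace X] [SecondCountableTopology X] [MeasurableSpace X]
    [BorelSpace X] (μ ν : Measure X) : ENNReal :=
  ⨅ K ∈ couplings μ ν, ∫⁻ p, edist p.1 p.2 ∂K

/-- The underlying set of Wasserstein-1-space over `X`: the Borel probability measures
at finite distance from some Dirac measure. -/
structure WassersteinSpace (X : Type*) [MetricSpace X] [SecondCountableTopology X]
    [MeasurableSpace X] [BorelSpace X] where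
  toMeasure : Measure X
  isProbabilityMeasure : IsProbabilityMeasure toMeasure
  exists_dist_lt_top : ∃ x : X, wassersteinDist toMeasure (Measure.dirac x) < ⊤

/-- The points of the unit sphere of Euclidean 3-space. It is a type of its own (not a subtype)
because it carries the geodesic metric and not the chordal one. -/
@[ext] structure RoundSphere where
  val : EuclideanSpace ℝ (Fin 3)
  norm_val : ‖val‖ = 1

namespace RoundSphere

/-- The Riemannian (great circle) distance of the unit sphere: the angle `arccos ⟪x, y⟫`. -/
instance : MetricSpace RoundSphere where
  dist x y := InnerProductGeometry.angle x.val y.val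
  dist_self x := InnerProductGeometry.angle_self (by
    intro h
    have := x.norm_val
    simp [h] at this)
  dist_comm x y := InnerProductGeometry.angle_comm _ _
  dist_triangle x y z := InnerProductGeometry.angle_le_angle_add_angle _ _ _
  eq_of_dist_eq_zero {x y} h := by
    apply RoundSphere.ext
    rw [← InnerProductGeometry.inner_eq_mul_norm_iff_angle_eq_zero, x.norm_val, y.norm_val,
      mul_one, inner_eq_one_iff_of_norm_eq_one x.norm_val y.norm_val] at h
    · exact h
    · exact fun h0 => by simpa [h0] using x.norm_val
    · exact fun h0 => by simpa [h0] using y.norm_val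

theorem dist_eq (x y : RoundSphere) :
    dist x y = InnerProductGeometry.angle x.val y.val := rfl

instance : MeasurableSpace RoundSphere := borel RoundSphere

instance : BorelSpace RoundSphere := ⟨rfl⟩

theorem continuous_mk : Continuous
    (fun x : Metric.sphere (0 : EuclideanSpace ℝ (Fin 3)) 1 =>
      (⟨x.1, mem_sphere_zero_iff_norm.1 x.2⟩ : RoundSphere)) := by
  rw [continuous_iff_continuousAt]
  intro x
  rw [ContinuousAt, tendsto_iff_dist_tendsto_zero]
  have h : Continuous (fun y : Metric.sphere (0 : EuclideanSpace ℝ (Fin 3)) 1 =>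
      InnerProductGeometry.angle y.1 x.1) := by
    unfold InnerProductGeometry.angle
    have h1 : ∀ y : Metric.sphere (0 : EuclideanSpace ℝ (Fin 3)) 1, ‖y.1‖ = 1 :=
      fun y => mem_sphere_zero_iff_norm.1 y.2
    simp only [h1]
    fun_prop
  have h2 := h.tendsto x
  rwa [InnerProductGeometry.angle_self (by
    intro h0
    have := mem_sphere_zero_iff_norm.1 x.2
    simp [h0] at this)] at h2

instance : SecondCountableTopology RoundSphere := by
  have hs : Function.Surjective (fun x : Metric.sphere (0 : EuclideanSpace ℝ (Fin 3)) 1 =>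
      (⟨x.1, mem_sphere_zero_iff_norm.1 x.2⟩ : RoundSphere)) :=
    fun y => ⟨⟨y.val, mem_sphere_zero_iff_norm.2 y.norm_val⟩, rfl⟩
  have : TopologicalSpace.SeparableSpace RoundSphere :=
    hs.denseRange.separableSpace continuous_mk
  exact UniformSpace.secondCountable_of_separable RoundSphere

end RoundSphere

/-- The closed hemisphere. It is geodesically convex, so the restricted metric of the sphere is its
intrinsic one. -/
def hemisphere : Set RoundSphere := {x | 0 ≤ x.val 2}

/-- The boundary circle of the hemisphere. It is a great circle, so the restricted metric of the
sphere is its arc length metric. -/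
def equator : Set RoundSphere := {x | x.val 2 = 0}

/-- The point `Q + t` of the circle: `Q` moved by the arc length `t` in the positive direction. -/
def equatorShift (Q : equator) (t : ℝ) : equator :=
  ⟨⟨!₂[Real.cos t * Q.1.val 0 - Real.sin t * Q.1.val 1,
      Real.sin t * Q.1.val 0 + Real.cos t * Q.1.val 1, 0], by
    have h := Q.1.norm_val
    have h2 : Q.1.val 2 = 0 := Q.2
    rw [EuclideanSpace.norm_eq, Real.sqrt_eq_one] at h ⊢
    simp only [Fin.sum_univ_three, Real.norm_eq_abs, sq_abs, h2] at h
    simp [Fin.sum_univ_three]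
    nlinarith [Real.sin_sq_add_cos_sq t]⟩, by simp [equator]⟩

/-- The second derivative at `Q`, with respect to arc length on the circle, of the function
`d_P = dist P`. -/
def distSecondDeriv (P : RoundSphere) (Q : equator) : ℝ :=
  iteratedDeriv 2 (fun t : ℝ => dist P (equatorShift Q t : RoundSphere)) 0

/-- The cosine `k_P` of the distance of `P` from the circle. -/
def cosDistEquator (P : RoundSphere) : ℝ := Real.cos (Metric.infDist P equator)

/-- The density `½ (d_P'')⁺ + (1 - k_P) / (2π)` on the circle. -/
def hemisphereDensity (P : RoundSphere) (Q : equator) : ℝ :=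
  1 / 2 * max (distSecondDeriv P Q) 0 + (1 - cosDistEquator P) / (2 * Real.pi)

end

open Real Set

/-!
Let `P` and `P'` lie in the open hemisphere. The great circle through them meets the equator in a
point `Q`, from which `P` and `P'` are seen in the same direction, with cosine `c` against the
equator, at distances `r` and `r'`, so that `d(P, P') = |r - r'|`. Expressed through the arc length
`s ∈ (-π, π]` from `Q`, the density of `ι(P)` depends on `r` and `c` only. Its primitive vanishing
at `Q` takes the values `(c ± 1) / 2` at `±π` for every `r`. For fixed `s` it is nonincreasing in
`r` if `s ≥ 0` and nondecreasing if `s ≤ 0`. Hence coupling the quantiles of `ι(P)` and `ι(P')`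
moves all mass along geodesics issuing from `Q`, away from `Q` if `r ≤ r'`. Such a coupling is
optimal, because the distance from `Q` is a Kantorovich potential for it, and its cost is the
difference of the mean distances from `Q` under `ι(P')` and `ι(P)`. These mean distances are `r'`
and `r`.
-/

section Wasserstein

variable {X : Type*} [MetricSpace X] [SecondCountableTopology X] [MeasurableSpace X]
  [BorelSpace X]

theorem wassersteinDist_comm (μ ν : Measure X) : wassersteinDist μ ν = wassersteinDist ν μ := by
  suffices h : ∀ μ ν : Measure X, wassersteinDist μ ν ≤ wassersteinDist ν μ from
    le_antisymm (h μ ν) (h ν μ)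
  intro μ ν
  refine le_iInf₂ fun K hK => ?_
  have hswap : K.map Prod.swap ∈ couplings μ ν :=
    ⟨(Measure.map_map measurable_fst measurable_swap).trans hK.2,
      (Measure.map_map measurable_snd measurable_swap).trans hK.1⟩
  refine (iInf₂_le _ hswap).trans_eq ?_
  rw [lintegral_map measurable_edist measurable_swap]
  simp only [Prod.fst_swap, Prod.snd_swap, edist_comm]

theorem lintegral_edist_le_add_wassersteinDist (x : X) (μ ν : Measure X) :
    ∫⁻ y, edist x y ∂ν ≤ ∫⁻ y, edist x y ∂μ + wassersteinDist μ ν := by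
  simp only [wassersteinDist, ENNReal.add_iInf]
  refine le_iInf₂ fun K hK => ?_
  have hx : Measurable fun y => edist x y := by fun_prop
  calc ∫⁻ y, edist x y ∂ν = ∫⁻ p, edist x p.2 ∂K := by
        rw [← hK.2, lintegral_map hx measurable_snd]
    _ ≤ ∫⁻ p, (edist x p.1 + edist p.1 p.2) ∂K := lintegral_mono fun p => edist_triangle _ _ _
    _ = ∫⁻ y, edist x y ∂μ + ∫⁻ p, edist p.1 p.2 ∂K := by
        rw [lintegral_add_left (by fun_prop), ← hK.1, lintegral_map hx measurable_fst]

theorem wassersteinDist_map_le {Ω : Type*} [MeasurableSpace Ω] {μ : Measure Ω} {f g : Ω → X}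
    (hf : AEMeasurable f μ) (hg : AEMeasurable g μ) :
    wassersteinDist (μ.map f) (μ.map g) ≤ ∫⁻ ω, edist (f ω) (g ω) ∂μ := by
  have hfg := hf.prodMk hg
  have hcoupling : μ.map (fun ω => (f ω, g ω)) ∈ couplings (μ.map f) (μ.map g) :=
    ⟨AEMeasurable.map_map_of_aemeasurable measurable_fst.aemeasurable hfg,
      AEMeasurable.map_map_of_aemeasurable measurable_snd.aemeasurable hfg⟩
  refine (iInf₂_le _ hcoupling).trans_eq ?_
  rw [lintegral_map' measurable_edist.aemeasurable hfg]

theorem wassersteinDist_dirac_left (x : X) (ν : Measure X) [IsProbabilityMeasure ν] :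
    wassersteinDist (Measure.dirac x) ν = ∫⁻ y, edist x y ∂ν := by
  refine le_antisymm ?_ ?_
  · simpa [Measure.map_const] using
      wassersteinDist_map_le (μ := ν) (aemeasurable_const (b := x)) aemeasurable_id
  · simpa [lintegral_dirac' x (show Measurable fun y => edist x y by fun_prop)] using
      lintegral_edist_le_add_wassersteinDist x (Measure.dirac x) ν

/-- The function `edist x` is a Kantorovich potential for a coupling along geodesics issuing from
`x`. -/
theorem lintegral_edist_add_wassersteinDist_map {Ω : Type*} [MeasurableSpace Ω] {μ : Measure Ω}
    {f g : Ω → X} (hf : AEMeasurable f μ) (hg : AEMeasurable g μ) (x : X)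
    (h : ∀ᵐ ω ∂μ, edist x (f ω) + edist (f ω) (g ω) = edist x (g ω)) :
    ∫⁻ y, edist x y ∂μ.map f + wassersteinDist (μ.map f) (μ.map g) =
      ∫⁻ y, edist x y ∂μ.map g := by
  have hx : Measurable fun y => edist x y := by fun_prop
  refine le_antisymm ?_ (lintegral_edist_le_add_wassersteinDist x _ _)
  calc ∫⁻ y, edist x y ∂μ.map f + wassersteinDist (μ.map f) (μ.map g)
      ≤ ∫⁻ ω, edist x (f ω) ∂μ + ∫⁻ ω, edist (f ω) (g ω) ∂μ := by
        rw [lintegral_map' hx.aemeasurable hf]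
        gcongr
        exact wassersteinDist_map_le hf hg
    _ = ∫⁻ ω, edist x (g ω) ∂μ := by
        rw [← lintegral_congr_ae h, lintegral_add_left' (f := fun ω => edist x (f ω))
          (hx.comp_aemeasurable hf)]
    _ = ∫⁻ y, edist x y ∂μ.map g := by rw [lintegral_map' hx.aemeasurable hg]

end Wasserstein

theorem map_hausdorffMeasure_restrict {X Y : Type*} [MetricSpace X] [MeasurableSpace X]
    [BorelSpace X] [MetricSpace Y] [MeasurableSpace Y] [BorelSpace Y] {f : X → Y}
    (hf : Measurable f) {s : Set X} (hs : Isometry (s.domRestrict f)) {d : ℝ} (hd : 0 ≤ d) :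
    ((Measure.hausdorffMeasure d).restrict s).map f =
      (Measure.hausdorffMeasure d).restrict (f '' s) := by
  have hval := (isometry_subtype_coe (s := s)).map_hausdorffMeasure (d := d) (.inl hd)
  rw [Subtype.range_coe] at hval
  rw [← range_domRestrict, ← hs.map_hausdorffMeasure (.inl hd), ← hval,
    Measure.map_map hf measurable_subtype_coe]
  rfl

theorem withDensity_map {X Y : Type*} [MeasurableSpace X] [MeasurableSpace Y] {μ : Measure X}
    {f : X → Y} (hf : Measurable f) {g : Y → ENNReal} (hg : Measurable g) :
    (μ.map f).withDensity g = (μ.withDensity fun x => g (f x)).map f := by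
  ext A hA
  rw [withDensity_apply _ hA, setLIntegral_map hA hg hf, Measure.map_apply hf hA,
    withDensity_apply _ (hf hA)]

theorem map_symm_volume_restrict_Ioc (e : ℝ ≃o ℝ) {e' : ℝ → ℝ}
    (he : ∀ s, HasDerivAt e (e' s) s) (a b : ℝ) :
    (volume.restrict (Ioc (e a) (e b))).map e.symm =
      (volume.restrict (Ioc a b)).withDensity fun s => ENNReal.ofReal (e' s) := by
  have hmeas : Measurable e.symm := e.symm.continuous.measurable
  ext A hA
  have himage : e.symm ⁻¹' A ∩ Ioc (e a) (e b) = e '' (A ∩ Ioc a b) := by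
    rw [image_inter e.injective, e.image_Ioc, e.image_eq_preimage_symm]
  rw [Measure.map_apply hmeas hA, Measure.restrict_apply (hmeas hA), withDensity_apply _ hA,
    Measure.restrict_restrict hA, himage, ← setLIntegral_one,
    lintegral_image_eq_lintegral_deriv_mul_of_monotoneOn (hA.inter measurableSet_Ioc)
      (fun s _ => (he s).hasDerivWithinAt) (e.monotone.monotoneOn _)]
  simp only [mul_one]

theorem antitoneOn_of_antitoneOn_nonneg_of_antitoneOn_nonpos {S : Set ℝ} (hS : S.OrdConnected)
    {f g : ℝ → ℝ} (hg : ContinuousOn g S) (hpos : AntitoneOn f {x ∈ S | 0 ≤ g x})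
    (hneg : AntitoneOn f {x ∈ S | g x ≤ 0}) : AntitoneOn f S := by
  intro x hx y hy hxy
  have hsub : uIcc x y ⊆ S := hS.uIcc_subset hx hy
  rcases le_total 0 (g x) with hgx | hgx <;> rcases le_total 0 (g y) with hgy | hgy
  · exact hpos ⟨hx, hgx⟩ ⟨hy, hgy⟩ hxy
  · obtain ⟨z, hz, hgz⟩ := intermediate_value_uIcc (hg.mono hsub) (mem_uIcc_of_ge hgy hgx)
    have hzS := hsub hz
    rw [uIcc_of_le hxy] at hz
    exact (hneg ⟨hzS, hgz.le⟩ ⟨hy, hgy⟩ hz.2).trans (hpos ⟨hx, hgx⟩ ⟨hzS, hgz.ge⟩ hz.1)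
  · obtain ⟨z, hz, hgz⟩ := intermediate_value_uIcc (hg.mono hsub) (mem_uIcc_of_le hgx hgy)
    have hzS := hsub hz
    rw [uIcc_of_le hxy] at hz
    exact (hpos ⟨hzS, hgz.ge⟩ ⟨hy, hgy⟩ hz.2).trans (hneg ⟨hx, hgx⟩ ⟨hzS, hgz.le⟩ hz.1)
  · exact hneg ⟨hx, hgx⟩ ⟨hy, hgy⟩ hxy

/-! ### Spherical triangles -/

/-- The cosine of the side opposite to the angle with cosine `c` in a spherical triangle
with adjacent sides `r` and `s`. -/
noncomputable def cosSide (r c s : ℝ) : ℝ := cos r * cos s + c * sin r * sin s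

/-- The derivative of `cosSide r c s` with respect to `s`. -/
noncomputable def cosSideDeriv (r c s : ℝ) : ℝ := -(cos r * sin s) + c * sin r * cos s

/-- The amplitude `k` in `cosSide r c s = k * cos (s - θ)`. For a point of the sphere it is the
number `k_P`. -/
noncomputable def cosSideMax (r c : ℝ) : ℝ := √(cos r ^ 2 + c ^ 2 * sin r ^ 2)

/-- The phase `θ` in `cosSide r c s = k * cos (s - θ)`. -/
noncomputable def sidePhase (r c : ℝ) : ℝ := Complex.arg ⟨cos r, c * sin r⟩

theorem hasDerivAt_cosSide (r c s : ℝ) : HasDerivAt (cosSide r c) (cosSideDeriv r c s) s :=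
  (((hasDerivAt_cos s).const_mul (cos r)).add
    ((hasDerivAt_sin s).const_mul (c * sin r))).congr_deriv (by simp only [cosSideDeriv]; ring)

theorem hasDerivAt_cosSideDeriv (r c s : ℝ) :
    HasDerivAt (cosSideDeriv r c) (-cosSide r c s) s :=
  (((hasDerivAt_sin s).const_mul (cos r)).neg.add
    ((hasDerivAt_cos s).const_mul (c * sin r))).congr_deriv (by simp only [cosSide]; ring)

theorem continuous_cosSide (r c : ℝ) : Continuous (cosSide r c) := by
  unfold cosSide
  fun_prop

theorem cosSide_comm (r c s : ℝ) : cosSide r c s = cosSide s c r := by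
  simp only [cosSide]
  ring

theorem cosSide_zero (r c : ℝ) : cosSide r c 0 = cos r := by simp [cosSide]

theorem cosSide_pi (r c : ℝ) : cosSide r c π = -cos r := by simp [cosSide]

theorem cosSide_neg_neg (r c s : ℝ) : cosSide r (-c) (-s) = cosSide r c s := by
  simp [cosSide]

theorem cosSide_pi_sub_pi_sub (r c s : ℝ) : cosSide (π - r) c (π - s) = cosSide r c s := by
  simp [cosSide]

theorem cosSide_pi_sub_neg (r c s : ℝ) : cosSide (π - r) (-c) s = -cosSide r c s := by
  simp only [cosSide, cos_pi_sub, sin_pi_sub]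
  ring

theorem cosSide_sub_pi (r c s : ℝ) : cosSide r c (s - π) = -cosSide r c s := by
  simp only [cosSide, cos_sub_pi, sin_sub_pi]
  ring

theorem sin_sub_mul_cosSide (r c s t u : ℝ) :
    sin (u - s) * cosSide r c t = sin (u - t) * cosSide r c s + sin (t - s) * cosSide r c u := by
  simp only [cosSide, sin_sub]
  ring

theorem cosSide_nonneg_of_mem_Icc {r c s t u : ℝ} (hs : 0 ≤ cosSide r c s)
    (hu : 0 ≤ cosSide r c u) (ht : t ∈ Icc s u) (hsu : u - s < π) : 0 ≤ cosSide r c t := by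
  obtain ⟨hst, htu⟩ := ht
  rcases (hst.trans htu).eq_or_lt with rfl | hlt
  · rwa [le_antisymm htu hst]
  have hsin_pos : 0 < sin (u - s) := sin_pos_of_pos_of_lt_pi (sub_pos.2 hlt) hsu
  have hsin_tu : 0 ≤ sin (u - t) := sin_nonneg_of_nonneg_of_le_pi (by linarith) (by linarith)
  have hsin_st : 0 ≤ sin (t - s) := sin_nonneg_of_nonneg_of_le_pi (by linarith) (by linarith)
  refine nonneg_of_mul_nonneg_right (a := sin (u - s)) ?_ hsin_pos
  rw [sin_sub_mul_cosSide]
  positivity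

theorem cosSide_nonpos_of_mem_Icc {r c s t u : ℝ} (hs : cosSide r c s ≤ 0)
    (hu : cosSide r c u ≤ 0) (ht : t ∈ Icc s u) (hsu : u - s < π) : cosSide r c t ≤ 0 := by
  rw [← neg_nonneg, ← cosSide_pi_sub_neg] at *
  exact cosSide_nonneg_of_mem_Icc hs hu ht hsu

theorem cosSideMax_nonneg (r c : ℝ) : 0 ≤ cosSideMax r c := sqrt_nonneg _

theorem cosSideMax_sq (r c : ℝ) : cosSideMax r c ^ 2 = cos r ^ 2 + c ^ 2 * sin r ^ 2 :=
  sq_sqrt (by positivity)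

theorem cosSideMax_neg (r c : ℝ) : cosSideMax r (-c) = cosSideMax r c := by
  simp [cosSideMax]

theorem cosSideMax_pi_sub (r c : ℝ) : cosSideMax (π - r) c = cosSideMax r c := by
  simp [cosSideMax]

theorem one_sub_cosSideMax_sq (r c : ℝ) :
    1 - cosSideMax r c ^ 2 = (1 - c ^ 2) * sin r ^ 2 := by
  rw [cosSideMax_sq, cos_sq']
  ring

theorem cosSideMax_pos {r : ℝ} (hr : 0 < cos r) (c : ℝ) : 0 < cosSideMax r c :=
  sqrt_pos.2 (by positivity)

theorem cosSideMax_lt_one {r c : ℝ} (hr : r ∈ Ioo 0 π) (hc : c ^ 2 < 1) :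
    cosSideMax r c < 1 := by
  have hsin := sin_pos_of_mem_Ioo hr
  have hsq : 0 < (1 - c ^ 2) * sin r ^ 2 := mul_pos (by linarith) (by positivity)
  rw [← one_sub_cosSideMax_sq, sub_pos] at hsq
  exact lt_of_pow_lt_pow_left₀ 2 zero_le_one (by rwa [one_pow])

theorem norm_sideVector (r c : ℝ) : ‖(⟨cos r, c * sin r⟩ : ℂ)‖ = cosSideMax r c := by
  rw [Complex.norm_eq_sqrt_sq_add_sq, cosSideMax, mul_pow]

theorem cosSideMax_mul_cos_sidePhase (r c : ℝ) :
    cosSideMax r c * cos (sidePhase r c) = cos r := by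
  rw [← norm_sideVector, sidePhase, Complex.norm_mul_cos_arg]

theorem cosSideMax_mul_sin_sidePhase (r c : ℝ) :
    cosSideMax r c * sin (sidePhase r c) = c * sin r := by
  rw [← norm_sideVector, sidePhase, Complex.norm_mul_sin_arg]

theorem cosSide_eq_mul_cos (r c s : ℝ) :
    cosSide r c s = cosSideMax r c * cos (s - sidePhase r c) := by
  rw [cosSide, ← cosSideMax_mul_cos_sidePhase r c, ← cosSideMax_mul_sin_sidePhase r c, cos_sub]
  ring

theorem cosSideDeriv_eq_mul_sin (r c s : ℝ) :
    cosSideDeriv r c s = -(cosSideMax r c * sin (s - sidePhase r c)) := by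
  rw [cosSideDeriv, ← cosSideMax_mul_cos_sidePhase r c, ← cosSideMax_mul_sin_sidePhase r c,
    sin_sub]
  ring

theorem abs_sidePhase_le {r c : ℝ} (hr : 0 ≤ cos r) : |sidePhase r c| ≤ π / 2 :=
  Complex.abs_arg_le_pi_div_two_iff.2 hr

theorem cosSide_le_cosSideMax (r c s : ℝ) : cosSide r c s ≤ cosSideMax r c := by
  rw [cosSide_eq_mul_cos]
  exact mul_le_of_le_one_right (cosSideMax_nonneg r c) (cos_le_one _)

theorem cosSide_sidePhase (r c : ℝ) : cosSide r c (sidePhase r c) = cosSideMax r c := by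
  rw [cosSide_eq_mul_cos, sub_self, cos_zero, mul_one]

theorem cosSide_sq_add_cosSideDeriv_sq (r c s : ℝ) :
    cosSide r c s ^ 2 + cosSideDeriv r c s ^ 2 = cosSideMax r c ^ 2 := by
  rw [cosSide_eq_mul_cos, cosSideDeriv_eq_mul_sin]
  linear_combination cosSideMax r c ^ 2 * sin_sq_add_cos_sq (s - sidePhase r c)

theorem one_sub_cosSide_sq_pos {r c : ℝ} (hr : r ∈ Ioo 0 π) (hc : c ^ 2 < 1) (s : ℝ) :
    0 < 1 - cosSide r c s ^ 2 := by
  have hsum := cosSide_sq_add_cosSideDeriv_sq r c s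
  have hmax := cosSideMax_lt_one hr hc
  nlinarith [cosSideMax_nonneg r c, sq_nonneg (cosSideDeriv r c s)]

/-- The derivative with respect to `s` of the side with cosine `cosSide r c s`. -/
noncomputable def sideDeriv (r c s : ℝ) : ℝ := -cosSideDeriv r c s / √(1 - cosSide r c s ^ 2)

/-- The second derivative with respect to `s` of the side with cosine `cosSide r c s`. -/
noncomputable def sideDeriv2 (r c s : ℝ) : ℝ :=
  (1 - cosSideMax r c ^ 2) * cosSide r c s /
    ((1 - cosSide r c s ^ 2) * √(1 - cosSide r c s ^ 2))

theorem hasDerivAt_arccos_cosSide {r c : ℝ} (hr : r ∈ Ioo 0 π) (hc : c ^ 2 < 1) (s : ℝ) :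
    HasDerivAt (fun s => arccos (cosSide r c s)) (sideDeriv r c s) s := by
  have hD := one_sub_cosSide_sq_pos hr hc s
  have hne_neg_one : cosSide r c s ≠ -1 := fun h => by norm_num [h] at hD
  have hne_one : cosSide r c s ≠ 1 := fun h => by norm_num [h] at hD
  refine ((hasDerivAt_arccos hne_neg_one hne_one).comp s
    (hasDerivAt_cosSide r c s)).congr_deriv ?_
  simp only [sideDeriv]
  ring

theorem hasDerivAt_sideDeriv {r c : ℝ} (hr : r ∈ Ioo 0 π) (hc : c ^ 2 < 1) (s : ℝ) :
    HasDerivAt (sideDeriv r c) (sideDeriv2 r c s) s := by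
  have hD := one_sub_cosSide_sq_pos hr hc s
  have hw := sqrt_pos.2 hD
  have hw_sq := sq_sqrt hD.le
  have hw_deriv := (((hasDerivAt_cosSide r c s).pow 2).const_sub 1).sqrt hD.ne'
  refine ((hasDerivAt_cosSideDeriv r c s).neg.div hw_deriv hw.ne').congr_deriv ?_
  simp only [Pi.neg_apply, Pi.pow_apply, neg_neg, sideDeriv2]
  set w := √(1 - cosSide r c s ^ 2)
  rw [← hw_sq]
  field_simp
  rw [← cosSide_sq_add_cosSideDeriv_sq r c s, hw_sq]
  ring

theorem continuous_sideDeriv {r c : ℝ} (hr : r ∈ Ioo 0 π) (hc : c ^ 2 < 1) :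
    Continuous (sideDeriv r c) :=
  continuous_iff_continuousAt.2 fun s => (hasDerivAt_sideDeriv hr hc s).continuousAt

theorem continuous_sideDeriv2 {r c : ℝ} (hr : r ∈ Ioo 0 π) (hc : c ^ 2 < 1) :
    Continuous (sideDeriv2 r c) := by
  have hcont := continuous_cosSide r c
  unfold sideDeriv2
  refine Continuous.div (by fun_prop) (by fun_prop) fun s => ?_
  have hD := one_sub_cosSide_sq_pos hr hc s
  positivity

theorem continuous_posPart_sideDeriv2 {r c : ℝ} (hr : r ∈ Ioo 0 π) (hc : c ^ 2 < 1) :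
    Continuous fun s => max (sideDeriv2 r c s) 0 :=
  (continuous_sideDeriv2 hr hc).max continuous_const

theorem sideDeriv2_neg_neg (r c s : ℝ) : sideDeriv2 r (-c) (-s) = sideDeriv2 r c s := by
  simp only [sideDeriv2, cosSide_neg_neg, cosSideMax_neg]

theorem sideDeriv2_pi_sub_pi_sub (r c s : ℝ) :
    sideDeriv2 (π - r) c (π - s) = sideDeriv2 r c s := by
  simp only [sideDeriv2, cosSide_pi_sub_pi_sub, cosSideMax_pi_sub]

theorem sideDeriv2_sub_pi (r c s : ℝ) : sideDeriv2 r c (s - π) = -sideDeriv2 r c s := by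
  simp only [sideDeriv2, cosSide_sub_pi, neg_sq, mul_neg, neg_div]

theorem sideDeriv2_pi_sub_neg (r c s : ℝ) : sideDeriv2 (π - r) (-c) s = -sideDeriv2 r c s := by
  simp only [sideDeriv2, cosSide_pi_sub_neg, cosSideMax_pi_sub, cosSideMax_neg, neg_sq, mul_neg,
    neg_div]

theorem sideDeriv2_nonneg {r c : ℝ} (hr : r ∈ Ioo 0 π) (hc : c ^ 2 < 1) {s : ℝ}
    (hs : 0 ≤ cosSide r c s) : 0 ≤ sideDeriv2 r c s := by
  have hD := one_sub_cosSide_sq_pos hr hc s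
  have hmax : 0 ≤ 1 - cosSideMax r c ^ 2 := by
    rw [one_sub_cosSideMax_sq]
    exact mul_nonneg (by linarith) (sq_nonneg _)
  unfold sideDeriv2
  positivity

theorem sideDeriv2_nonpos {r c : ℝ} (hr : r ∈ Ioo 0 π) (hc : c ^ 2 < 1) {s : ℝ}
    (hs : cosSide r c s ≤ 0) : sideDeriv2 r c s ≤ 0 := by
  rw [← neg_nonneg, ← sideDeriv2_pi_sub_neg]
  refine sideDeriv2_nonneg ⟨by linarith [hr.2], by linarith [hr.1]⟩ (by rwa [neg_sq]) ?_
  rwa [cosSide_pi_sub_neg, neg_nonneg]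

theorem sideDeriv_zero {r : ℝ} (hr : r ∈ Ioo 0 π) (c : ℝ) : sideDeriv r c 0 = -c := by
  have hsin := sin_pos_of_mem_Ioo hr
  rw [sideDeriv, cosSide_zero, ← sin_sq, sqrt_sq hsin.le, cosSideDeriv, sin_zero, cos_zero]
  field_simp
  ring

theorem sideDeriv_sidePhase_add_pi_div_two (r c : ℝ) :
    sideDeriv r c (sidePhase r c + π / 2) = cosSideMax r c := by
  rw [sideDeriv, cosSideDeriv_eq_mul_sin, cosSide_eq_mul_cos]
  simp

theorem integral_sideDeriv2 {r c : ℝ} (hr : r ∈ Ioo 0 π) (hc : c ^ 2 < 1) (s t : ℝ) :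
    ∫ u in s..t, sideDeriv2 r c u = sideDeriv r c t - sideDeriv r c s :=
  intervalIntegral.integral_eq_sub_of_hasDerivAt (fun u _ => hasDerivAt_sideDeriv hr hc u)
    ((continuous_sideDeriv2 hr hc).intervalIntegrable _ _)

theorem integral_posPart_sideDeriv2_of_nonneg {r c : ℝ} (hr : r ∈ Ioo 0 π) (hc : c ^ 2 < 1)
    {s t : ℝ} (hst : s ≤ t) (h : ∀ u ∈ Icc s t, 0 ≤ cosSide r c u) :
    ∫ u in s..t, max (sideDeriv2 r c u) 0 = sideDeriv r c t - sideDeriv r c s := by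
  rw [← integral_sideDeriv2 hr hc]
  refine intervalIntegral.integral_congr fun u hu => ?_
  rw [uIcc_of_le hst] at hu
  exact max_eq_left (sideDeriv2_nonneg hr hc (h u hu))

theorem integral_posPart_sideDeriv2_of_nonpos {r c : ℝ} (hr : r ∈ Ioo 0 π) (hc : c ^ 2 < 1)
    {s t : ℝ} (hst : s ≤ t) (h : ∀ u ∈ Icc s t, cosSide r c u ≤ 0) :
    ∫ u in s..t, max (sideDeriv2 r c u) 0 = 0 := by
  refine (intervalIntegral.integral_congr (g := 0) fun u hu => ?_).trans
    intervalIntegral.integral_zero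
  rw [uIcc_of_le hst] at hu
  exact max_eq_right (sideDeriv2_nonpos hr hc (h u hu))

theorem integral_posPart_sideDeriv2_of_cosSide_nonneg {r c s : ℝ} (hr : r ∈ Ioo 0 π)
    (hcos : 0 ≤ cos r) (hc : c ^ 2 < 1) (hs : s ∈ Ico 0 π) (hcosSide : 0 ≤ cosSide r c s) :
    ∫ u in 0..s, max (sideDeriv2 r c u) 0 = sideDeriv r c s + c := by
  rw [integral_posPart_sideDeriv2_of_nonneg hr hc hs.1 fun u hu =>
    cosSide_nonneg_of_mem_Icc (by rwa [cosSide_zero]) hcosSide hu (by simpa using hs.2),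
    sideDeriv_zero hr, sub_neg_eq_add]

theorem integral_posPart_sideDeriv2_pi_of_cos_nonneg {r c : ℝ} (hr : r ∈ Ioo 0 π)
    (hcos : 0 ≤ cos r) (hc : c ^ 2 < 1) :
    ∫ u in 0..π, max (sideDeriv2 r c u) 0 = cosSideMax r c + c := by
  obtain ⟨hphase, hphase'⟩ := abs_le.1 (abs_sidePhase_le (c := c) hcos)
  have hint (a b : ℝ) : IntervalIntegrable (fun u => max (sideDeriv2 r c u) 0) volume a b :=
    (continuous_posPart_sideDeriv2 hr hc).intervalIntegrable a b
  rw [← intervalIntegral.integral_add_adjacent_intervals (b := sidePhase r c + π / 2)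
    (hint _ _) (hint _ _), integral_posPart_sideDeriv2_of_nonneg hr hc (by linarith) ?_,
    integral_posPart_sideDeriv2_of_nonpos hr hc (by linarith) ?_, sideDeriv_zero hr,
    sideDeriv_sidePhase_add_pi_div_two, sub_neg_eq_add, add_zero]
  · intro u hu
    rw [cosSide_eq_mul_cos]
    exact mul_nonpos_of_nonneg_of_nonpos (cosSideMax_nonneg r c)
      (cos_nonpos_of_pi_div_two_le_of_le (by linarith [hu.1]) (by linarith [hu.2]))
  · intro u hu
    rw [cosSide_eq_mul_cos]
    exact mul_nonneg (cosSideMax_nonneg r c)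
      (cos_nonneg_of_mem_Icc ⟨by linarith [hu.1], by linarith [hu.2]⟩)

theorem integral_posPart_sideDeriv2_pi {r c : ℝ} (hr : r ∈ Ioo 0 π) (hc : c ^ 2 < 1) :
    ∫ u in 0..π, max (sideDeriv2 r c u) 0 = cosSideMax r c + c := by
  rcases le_total 0 (cos r) with hcos | hcos
  · exact integral_posPart_sideDeriv2_pi_of_cos_nonneg hr hcos hc
  · have hr' : π - r ∈ Ioo 0 π := ⟨by linarith [hr.2], by linarith [hr.1]⟩
    have htotal := integral_posPart_sideDeriv2_pi_of_cos_nonneg hr'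
      (by rw [cos_pi_sub]; linarith) hc
    rw [← cosSideMax_pi_sub, ← htotal]
    simpa only [sideDeriv2_pi_sub_pi_sub, sub_self, sub_zero] using
      intervalIntegral.integral_comp_sub_left (a := 0) (b := π)
        (fun u => max (sideDeriv2 (π - r) c u) 0) π

theorem integral_posPart_sideDeriv2_of_cosSide_nonpos {r c s : ℝ} (hr : r ∈ Ioo 0 π)
    (hcos : 0 ≤ cos r) (hc : c ^ 2 < 1) (hs : s ∈ Ioc 0 π) (hcosSide : cosSide r c s ≤ 0) :
    ∫ u in 0..s, max (sideDeriv2 r c u) 0 = cosSideMax r c + c := by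
  have hint (a b : ℝ) : IntervalIntegrable (fun u => max (sideDeriv2 r c u) 0) volume a b :=
    (continuous_posPart_sideDeriv2 hr hc).intervalIntegrable a b
  have htail : ∫ u in s..π, max (sideDeriv2 r c u) 0 = 0 :=
    integral_posPart_sideDeriv2_of_nonpos hr hc hs.2 fun u hu =>
      cosSide_nonpos_of_mem_Icc hcosSide (by rw [cosSide_pi]; linarith) hu (by linarith [hs.1])
  rw [← integral_posPart_sideDeriv2_pi hr hc,
    ← intervalIntegral.integral_add_adjacent_intervals (hint 0 s) (hint s π), htail, add_zero]

/-! ### The density in arc length from a point of the circle -/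

/-- In terms of the arc length `s ∈ (-π, π]` from a point `Q` of the circle, the density on the
circle of the measure representing the point at distance `r` from `Q` in the direction with
cosine `c`. -/
noncomputable def sideDensity (r c s : ℝ) : ℝ :=
  1 / 2 * max (sideDeriv2 r c s) 0 + (1 - cosSideMax r c) / (2 * π)

/-- The primitive of `sideDensity r c` vanishing at `0`: a distribution function centred at the
base point of the circle instead of an end of `(-π, π]`. -/
noncomputable def sideCdf (r c s : ℝ) : ℝ := ∫ u in 0..s, sideDensity r c u

theorem continuous_sideDensity {r c : ℝ} (hr : r ∈ Ioo 0 π) (hc : c ^ 2 < 1) :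
    Continuous (sideDensity r c) :=
  ((continuous_posPart_sideDeriv2 hr hc).const_mul _).add_const _

theorem le_sideDensity (r c s : ℝ) : (1 - cosSideMax r c) / (2 * π) ≤ sideDensity r c s :=
  le_add_of_nonneg_left (by positivity)

theorem one_sub_cosSideMax_div_two_pi_pos {r c : ℝ} (hr : r ∈ Ioo 0 π) (hc : c ^ 2 < 1) :
    0 < (1 - cosSideMax r c) / (2 * π) :=
  div_pos (sub_pos.2 (cosSideMax_lt_one hr hc)) two_pi_pos

theorem sideDensity_pos {r c : ℝ} (hr : r ∈ Ioo 0 π) (hc : c ^ 2 < 1) (s : ℝ) :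
    0 < sideDensity r c s :=
  (one_sub_cosSideMax_div_two_pi_pos hr hc).trans_le (le_sideDensity r c s)

theorem sideDensity_neg_neg (r c s : ℝ) : sideDensity r (-c) (-s) = sideDensity r c s := by
  simp only [sideDensity, sideDeriv2_neg_neg, cosSideMax_neg]

theorem sideDensity_pi_sub_pi_sub (r c s : ℝ) :
    sideDensity (π - r) c (π - s) = sideDensity r c s := by
  simp only [sideDensity, sideDeriv2_pi_sub_pi_sub, cosSideMax_pi_sub]

theorem sideCdf_zero (r c : ℝ) : sideCdf r c 0 = 0 := intervalIntegral.integral_same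

theorem sideCdf_neg_neg (r c s : ℝ) : sideCdf r (-c) (-s) = -sideCdf r c s := by
  have hcomp := intervalIntegral.integral_comp_neg (a := 0) (b := s) (sideDensity r (-c))
  simp only [sideDensity_neg_neg, neg_zero] at hcomp
  rw [sideCdf, sideCdf, hcomp, intervalIntegral.integral_symm]

theorem sideCdf_eq_integral_posPart {r c : ℝ} (hr : r ∈ Ioo 0 π) (hc : c ^ 2 < 1) (s : ℝ) :
    sideCdf r c s = 1 / 2 * (∫ u in 0..s, max (sideDeriv2 r c u) 0) +
      (1 - cosSideMax r c) / (2 * π) * s := by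
  have hint : IntervalIntegrable (fun u => max (sideDeriv2 r c u) 0) volume 0 s :=
    (continuous_posPart_sideDeriv2 hr hc).intervalIntegrable 0 s
  simp only [sideCdf, sideDensity]
  rw [intervalIntegral.integral_add (hint.const_mul _) intervalIntegrable_const,
    intervalIntegral.integral_const_mul, intervalIntegral.integral_const, smul_eq_mul, sub_zero,
    mul_comm s]

theorem sideCdf_pi {r c : ℝ} (hr : r ∈ Ioo 0 π) (hc : c ^ 2 < 1) :
    sideCdf r c π = (1 + c) / 2 := by
  rw [sideCdf_eq_integral_posPart hr hc, integral_posPart_sideDeriv2_pi hr hc]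
  field_simp
  ring

theorem sideCdf_neg_pi {r c : ℝ} (hr : r ∈ Ioo 0 π) (hc : c ^ 2 < 1) :
    sideCdf r c (-π) = (c - 1) / 2 := by
  rw [← neg_neg c, sideCdf_neg_neg, sideCdf_pi hr (by rwa [neg_sq])]
  ring

theorem sideCdf_pi_sub_pi_sub {r c : ℝ} (hr : r ∈ Ioo 0 π) (hc : c ^ 2 < 1) (s : ℝ) :
    sideCdf (π - r) c (π - s) = (1 + c) / 2 - sideCdf r c s := by
  have hint (a b : ℝ) : IntervalIntegrable (sideDensity r c) volume a b :=
    (continuous_sideDensity hr hc).intervalIntegrable a b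
  have hcomp := intervalIntegral.integral_comp_sub_left (a := s) (b := π)
    (sideDensity (π - r) c) π
  simp only [sideDensity_pi_sub_pi_sub, sub_self] at hcomp
  rw [← sideCdf_pi hr hc, sideCdf, ← hcomp]
  exact (intervalIntegral.integral_interval_sub_left (hint 0 π) (hint 0 s)).symm

theorem sideCdf_eq_of_cosSide_nonneg {r c s : ℝ} (hr : r ∈ Ioo 0 π) (hcos : 0 ≤ cos r)
    (hc : c ^ 2 < 1) (hs : s ∈ Ico 0 π) (hcosSide : 0 ≤ cosSide r c s) :
    sideCdf r c s =
      1 / 2 * (sideDeriv r c s + c) + (1 - cosSideMax r c) / (2 * π) * s := by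
  rw [sideCdf_eq_integral_posPart hr hc,
    integral_posPart_sideDeriv2_of_cosSide_nonneg hr hcos hc hs hcosSide]

theorem sideCdf_eq_of_cosSide_nonpos {r c s : ℝ} (hr : r ∈ Ioo 0 π) (hcos : 0 ≤ cos r)
    (hc : c ^ 2 < 1) (hs : s ∈ Ioc 0 π) (hcosSide : cosSide r c s ≤ 0) :
    sideCdf r c s =
      1 / 2 * (cosSideMax r c + c) + (1 - cosSideMax r c) / (2 * π) * s := by
  rw [sideCdf_eq_integral_posPart hr hc,
    integral_posPart_sideDeriv2_of_cosSide_nonpos hr hcos hc hs hcosSide]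

theorem hasDerivAt_sideDeriv_left {r c s : ℝ} (hD : 0 < 1 - cosSide r c s ^ 2) :
    HasDerivAt (fun r => sideDeriv r c s) (-((1 - c ^ 2) * sin r * sin s /
      ((1 - cosSide r c s ^ 2) * √(1 - cosSide r c s ^ 2)))) r := by
  have hw := sqrt_pos.2 hD
  have hw_sq := sq_sqrt hD.le
  have hside : HasDerivAt (fun r => cosSide r c s) (cosSideDeriv s c r) r :=
    (hasDerivAt_cosSide s c r).congr_of_eventuallyEq (.of_forall fun r => cosSide_comm r c s)
  have hderiv : HasDerivAt (fun r => cosSideDeriv r c s) (sin r * sin s + c * cos r * cos s) r :=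
    (((hasDerivAt_cos r).mul_const (sin s)).neg.add
      (((hasDerivAt_sin r).const_mul c).mul_const (cos s))).congr_deriv (by ring)
  have hnum : (sin r * sin s + c * cos r * cos s) * (1 - cosSide r c s ^ 2) +
      cosSide r c s * cosSideDeriv s c r * cosSideDeriv r c s = (1 - c ^ 2) * sin r * sin s := by
    have hsin_r := sin_sq r
    have hsin_s := sin_sq s
    simp only [cosSide, cosSideDeriv]
    grind
  refine (hderiv.neg.div ((hside.pow 2).const_sub 1 |>.sqrt hD.ne') hw.ne').congr_deriv ?_
  simp only [Pi.neg_apply, Pi.pow_apply]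
  set w := √(1 - cosSide r c s ^ 2)
  rw [← hw_sq] at hnum ⊢
  field_simp
  push_cast
  linear_combination -2 * hnum

theorem hasDerivAt_cosSideMax {r c : ℝ} (h : 0 < cosSideMax r c) :
    HasDerivAt (fun r => cosSideMax r c)
      (-((1 - c ^ 2) * sin r * cos r / cosSideMax r c)) r := by
  have hsq := (((hasDerivAt_cos r).pow 2).add (((hasDerivAt_sin r).pow 2).const_mul (c ^ 2))).sqrt
    (sqrt_pos.1 h).ne'
  refine hsq.congr_deriv ?_
  simp only [cosSideMax, Pi.add_apply, Pi.pow_apply] at h ⊢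
  field_simp
  ring

theorem continuous_cosSideMax (c : ℝ) : Continuous fun r => cosSideMax r c := by
  unfold cosSideMax
  fun_prop

theorem antitoneOn_cosSideMax {c : ℝ} (hc : c ^ 2 < 1) :
    AntitoneOn (fun r => cosSideMax r c) (Icc 0 (π / 2)) := by
  intro r hr r' hr' hle
  have hsin : sin r ≤ sin r' :=
    sin_le_sin_of_le_of_le_pi_div_two (by linarith [hr.1, pi_pos]) hr'.2 hle
  have hsin_nonneg : 0 ≤ sin r :=
    sin_nonneg_of_nonneg_of_le_pi hr.1 (by linarith [hr.2, pi_pos])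
  refine (sq_le_sq₀ (cosSideMax_nonneg _ _) (cosSideMax_nonneg _ _)).1 ?_
  have hmul : (1 - c ^ 2) * sin r ^ 2 ≤ (1 - c ^ 2) * sin r' ^ 2 :=
    mul_le_mul_of_nonneg_left (by gcongr) (by linarith)
  rw [← one_sub_cosSideMax_sq, ← one_sub_cosSideMax_sq] at hmul
  linarith

theorem cos_mul_le_of_le_pi_div_two {r c s : ℝ} (hs : s ∈ Icc 0 (π / 2)) :
    cos r * s ≤ π * cosSideMax r c * sin s := by
  have hcos : cos r ≤ cosSideMax r c := by
    rw [← cosSide_zero r c]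
    exact cosSide_le_cosSideMax r c 0
  have hjordan : s ≤ π * sin s := by
    have h := mul_le_sin hs.1 hs.2
    rw [div_mul_eq_mul_div, div_le_iff₀ pi_pos] at h
    linarith [hs.1]
  calc cos r * s ≤ cosSideMax r c * s := mul_le_mul_of_nonneg_right hcos hs.1
    _ ≤ cosSideMax r c * (π * sin s) := mul_le_mul_of_nonneg_left hjordan (cosSideMax_nonneg r c)
    _ = π * cosSideMax r c * sin s := by ring

theorem sq_cosSideMax_mul_sin_sub_sq_cos (r c s : ℝ) :
    (cosSideMax r c * sin s) ^ 2 - cos r ^ 2 = -cosSide r c s * cosSide r c (-s) := by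
  rw [mul_pow, cosSideMax_sq]
  simp only [cosSide, cos_neg, sin_neg]
  linear_combination cos r ^ 2 * sin_sq_add_cos_sq s

theorem cos_mul_le_of_pi_div_two_le {r c s : ℝ} (hcos : 0 ≤ cos r) (hs : s ∈ Icc (π / 2) π)
    (hcosSide : 0 ≤ cosSide r c s) : cos r * s ≤ π * cosSideMax r c * sin s := by
  have hsin : 0 ≤ sin s := sin_nonneg_of_nonneg_of_le_pi (by linarith [hs.1, pi_pos]) hs.2
  have hcos_s : cos s ≤ 0 := cos_nonpos_of_pi_div_two_le_of_le hs.1 (by linarith [hs.2, pi_pos])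
  have hneg : cosSide r c (-s) ≤ 0 := by
    have hsum : cosSide r c s + cosSide r c (-s) = 2 * (cos r * cos s) := by
      simp only [cosSide, cos_neg, sin_neg]
      ring
    linarith [mul_nonpos_of_nonneg_of_nonpos hcos hcos_s]
  have hamplitude : 0 ≤ cosSideMax r c * sin s := mul_nonneg (cosSideMax_nonneg r c) hsin
  have hle : cos r ≤ cosSideMax r c * sin s := by
    refine (sq_le_sq₀ hcos hamplitude).1 (sub_nonneg.1 ?_)
    rw [sq_cosSideMax_mul_sin_sub_sq_cos]
    exact mul_nonneg_of_nonpos_of_nonpos (neg_nonpos.2 hcosSide) hneg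
  calc cos r * s ≤ cosSideMax r c * sin s * π :=
        mul_le_mul hle hs.2 (by linarith [hs.1, pi_pos]) hamplitude
    _ = π * cosSideMax r c * sin s := by ring

theorem cos_mul_le_pi_mul_cosSideMax_mul_sin {r c s : ℝ} (hcos : 0 ≤ cos r) (hs : s ∈ Icc 0 π)
    (hcosSide : 0 ≤ cosSide r c s) : cos r * s ≤ π * cosSideMax r c * sin s := by
  rcases le_total s (π / 2) with h | h
  · exact cos_mul_le_of_le_pi_div_two ⟨hs.1, h⟩
  · exact cos_mul_le_of_pi_div_two_le hcos ⟨h, hs.2⟩ hcosSide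

theorem hasDerivAt_sideCdf_formula {r c s : ℝ} (hD : 0 < 1 - cosSide r c s ^ 2)
    (hmax : 0 < cosSideMax r c) :
    HasDerivAt (fun r => 1 / 2 * (sideDeriv r c s + c) + (1 - cosSideMax r c) / (2 * π) * s)
      ((1 - c ^ 2) * sin r / 2 * (cos r * s / (π * cosSideMax r c) -
        sin s / ((1 - cosSide r c s ^ 2) * √(1 - cosSide r c s ^ 2)))) r := by
  refine ((((hasDerivAt_sideDeriv_left hD).add_const c).const_mul (1 / 2)).add
    ((((hasDerivAt_cosSideMax hmax).const_sub 1).div_const (2 * π)).mul_const s)).congr_deriv ?_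
  field_simp
  ring

theorem sideCdf_formula_deriv_nonpos {r c s : ℝ} (hr : r ∈ Ioo 0 π) (hcos : 0 < cos r)
    (hc : c ^ 2 < 1) (hs : s ∈ Icc 0 π) (hcosSide : 0 ≤ cosSide r c s) :
    (1 - c ^ 2) * sin r / 2 * (cos r * s / (π * cosSideMax r c) -
      sin s / ((1 - cosSide r c s ^ 2) * √(1 - cosSide r c s ^ 2))) ≤ 0 := by
  have hD := one_sub_cosSide_sq_pos hr hc s
  have hD_le : 1 - cosSide r c s ^ 2 ≤ 1 := by linarith [sq_nonneg (cosSide r c s)]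
  have hmax := cosSideMax_pos hcos c
  have hsin_r := sin_pos_of_mem_Ioo hr
  have hfactor : 0 ≤ (1 - c ^ 2) * sin r / 2 :=
    div_nonneg (mul_nonneg (by linarith) hsin_r.le) zero_le_two
  refine mul_nonpos_of_nonneg_of_nonpos hfactor (sub_nonpos.2 ?_)
  calc cos r * s / (π * cosSideMax r c) ≤ sin s := by
        rw [div_le_iff₀ (by positivity), mul_comm (sin s)]
        exact cos_mul_le_pi_mul_cosSideMax_mul_sin hcos.le hs hcosSide
    _ ≤ sin s / ((1 - cosSide r c s ^ 2) * √(1 - cosSide r c s ^ 2)) :=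
        le_div_self (sin_nonneg_of_mem_Icc hs) (by positivity)
          (mul_le_one₀ hD_le (sqrt_nonneg _) (sqrt_le_one.2 hD_le))

theorem Ioc_zero_pi_div_two_subset : Ioc 0 (π / 2) ⊆ Ioo 0 π :=
  fun _ hr => ⟨hr.1, by linarith [hr.2, pi_pos]⟩

theorem cos_nonneg_of_mem_Ioc {r : ℝ} (hr : r ∈ Ioc 0 (π / 2)) : 0 ≤ cos r :=
  cos_nonneg_of_mem_Icc ⟨by linarith [hr.1, pi_pos], hr.2⟩

theorem antitoneOn_sideCdf_cosSide_nonneg {c s : ℝ} (hc : c ^ 2 < 1) (hs : s ∈ Ico 0 π) :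
    AntitoneOn (fun r => sideCdf r c s) {r ∈ Ioc 0 (π / 2) | 0 ≤ cosSide r c s} := by
  rintro r ⟨hr, hside⟩ r' ⟨hr', hside'⟩ hle
  have hmem : ∀ ρ ∈ Icc r r', ρ ∈ Ioc 0 (π / 2) ∧ 0 ≤ cosSide ρ c s := by
    intro ρ hρ
    refine ⟨⟨hr.1.trans_le hρ.1, hρ.2.trans hr'.2⟩, ?_⟩
    rw [cosSide_comm] at hside hside' ⊢
    exact cosSide_nonneg_of_mem_Icc hside hside' hρ (by linarith [hr.1, hr'.2, pi_pos])
  have hD (ρ) (hρ : ρ ∈ Icc r r') : 0 < 1 - cosSide ρ c s ^ 2 :=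
    one_sub_cosSide_sq_pos (Ioc_zero_pi_div_two_subset (hmem ρ hρ).1) hc s
  have hcos (ρ) (hρ : ρ ∈ interior (Icc r r')) : 0 < cos ρ := by
    rw [interior_Icc] at hρ
    exact cos_pos_of_mem_Ioo ⟨by linarith [hr.1, hρ.1, pi_pos], hρ.2.trans_le hr'.2⟩
  have hsideDeriv : ContinuousOn (fun ρ => sideDeriv ρ c s) (Icc r r') := fun ρ hρ =>
    (hasDerivAt_sideDeriv_left (hD ρ hρ)).continuousAt.continuousWithinAt
  have hcosSideMax : ContinuousOn (fun ρ => cosSideMax ρ c) (Icc r r') :=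
    (continuous_cosSideMax c).continuousOn
  have hanti := antitoneOn_of_hasDerivWithinAt_nonpos (convex_Icc r r')
    (f := fun r => 1 / 2 * (sideDeriv r c s + c) + (1 - cosSideMax r c) / (2 * π) * s)
    (by fun_prop)
    (fun ρ hρ => (hasDerivAt_sideCdf_formula (hD ρ (interior_subset hρ))
      (cosSideMax_pos (hcos ρ hρ) c)).hasDerivWithinAt)
    (fun ρ hρ => by
      obtain ⟨hρ', hside⟩ := hmem ρ (interior_subset hρ)
      exact sideCdf_formula_deriv_nonpos (Ioc_zero_pi_div_two_subset hρ') (hcos ρ hρ) hc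
        (Ico_subset_Icc_self hs) hside)
  dsimp only
  rw [sideCdf_eq_of_cosSide_nonneg (Ioc_zero_pi_div_two_subset hr) (cos_nonneg_of_mem_Ioc hr) hc
    hs hside, sideCdf_eq_of_cosSide_nonneg (Ioc_zero_pi_div_two_subset hr')
    (cos_nonneg_of_mem_Ioc hr') hc hs hside']
  exact hanti (left_mem_Icc.2 hle) (right_mem_Icc.2 hle) hle

theorem antitoneOn_sideCdf_cosSide_nonpos {c s : ℝ} (hc : c ^ 2 < 1) (hs : s ∈ Ioc 0 π) :
    AntitoneOn (fun r => sideCdf r c s) {r ∈ Ioc 0 (π / 2) | cosSide r c s ≤ 0} := by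
  rintro r ⟨hr, hside⟩ r' ⟨hr', hside'⟩ hle
  dsimp only
  rw [sideCdf_eq_of_cosSide_nonpos (Ioc_zero_pi_div_two_subset hr) (cos_nonneg_of_mem_Ioc hr) hc
    hs hside, sideCdf_eq_of_cosSide_nonpos (Ioc_zero_pi_div_two_subset hr')
    (cos_nonneg_of_mem_Ioc hr') hc hs hside']
  have hmax : cosSideMax r' c ≤ cosSideMax r c :=
    antitoneOn_cosSideMax hc (Ioc_subset_Icc_self hr) (Ioc_subset_Icc_self hr') hle
  have hs_le : s / (2 * π) ≤ 1 / 2 := by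
    rw [div_le_iff₀ two_pi_pos]
    linarith [hs.2]
  have hmul := mul_nonneg (sub_nonneg.2 hmax) (sub_nonneg.2 hs_le)
  linear_combination hmul

theorem antitoneOn_sideCdf_Ioc {c s : ℝ} (hc : c ^ 2 < 1) (hs : s ∈ Icc 0 π) :
    AntitoneOn (fun r => sideCdf r c s) (Ioc 0 (π / 2)) := by
  rcases hs.1.eq_or_lt with rfl | hs_pos
  · simp only [sideCdf_zero]
    exact antitoneOn_const
  rcases hs.2.eq_or_lt with rfl | hs_lt
  · intro r hr r' hr' _
    dsimp only
    rw [sideCdf_pi (Ioc_zero_pi_div_two_subset hr) hc,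
      sideCdf_pi (Ioc_zero_pi_div_two_subset hr') hc]
  refine antitoneOn_of_antitoneOn_nonneg_of_antitoneOn_nonpos ordConnected_Ioc
    (g := fun r => cosSide r c s) ?_ (antitoneOn_sideCdf_cosSide_nonneg hc ⟨hs.1, hs_lt⟩)
    (antitoneOn_sideCdf_cosSide_nonpos hc ⟨hs_pos, hs.2⟩)
  simp only [cosSide_comm _ c s]
  exact (continuous_cosSide s c).continuousOn

theorem antitoneOn_sideCdf {c s : ℝ} (hc : c ^ 2 < 1) (hs : s ∈ Icc 0 π) :
    AntitoneOn (fun r => sideCdf r c s) (Ioo 0 π) := by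
  have hleft := antitoneOn_sideCdf_Ioc hc hs
  have hright : AntitoneOn (fun r => sideCdf r c s) (Ico (π / 2) π) := by
    intro r hr r' hr' hle
    have hmem : ∀ ρ ∈ Ico (π / 2) π, π - ρ ∈ Ioc 0 (π / 2) := fun ρ hρ =>
      ⟨by linarith [hρ.2], by linarith [hρ.1]⟩
    have hrefl : sideCdf (π - r) c (π - s) ≤ sideCdf (π - r') c (π - s) :=
      antitoneOn_sideCdf_Ioc hc ⟨by linarith [hs.2], by linarith [hs.1]⟩ (hmem r' hr')
        (hmem r hr) (by linarith)
    rw [sideCdf_pi_sub_pi_sub ⟨by linarith [hr.1, pi_pos], hr.2⟩ hc,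
      sideCdf_pi_sub_pi_sub ⟨by linarith [hr'.1, pi_pos], hr'.2⟩ hc] at hrefl
    dsimp only
    linarith
  have hpi := pi_pos
  rw [← Ioc_union_Ico_eq_Ioo (b := π / 2) (by linarith) (by linarith)]
  exact hleft.union_right hright (isGreatest_Ioc (by linarith)) (isLeast_Ico (by linarith))

theorem monotoneOn_sideCdf {c s : ℝ} (hc : c ^ 2 < 1) (hs : s ∈ Icc (-π) 0) :
    MonotoneOn (fun r => sideCdf r c s) (Ioo 0 π) := by
  intro r hr r' hr' hle
  have hneg : sideCdf r' (-c) (-s) ≤ sideCdf r (-c) (-s) :=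
    antitoneOn_sideCdf (by rwa [neg_sq]) ⟨by linarith [hs.2], by linarith [hs.1]⟩ hr hr' hle
  rwa [sideCdf_neg_neg, sideCdf_neg_neg, neg_le_neg_iff] at hneg

theorem integral_pi_sub_mul_sideDeriv2 {r c : ℝ} (hr : r ∈ Ioo 0 π) (hc : c ^ 2 < 1) :
    ∫ s in 0..π, (π - s) * sideDeriv2 r c s = π * c + π - 2 * r := by
  have hside : ∫ s in 0..π, sideDeriv r c s = π - 2 * r := by
    rw [intervalIntegral.integral_eq_sub_of_hasDerivAt
      (fun s _ => hasDerivAt_arccos_cosSide hr hc s)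
      ((continuous_sideDeriv hr hc).intervalIntegrable 0 π), cosSide_pi, cosSide_zero, arccos_neg,
      arccos_cos hr.1.le hr.2.le]
    ring
  have hparts := intervalIntegral.integral_mul_deriv_eq_deriv_mul (a := 0) (b := π)
    (u := fun s => π - s) (u' := fun _ => -1) (fun s _ => (hasDerivAt_id s).const_sub π)
    (fun s _ => hasDerivAt_sideDeriv hr hc s) intervalIntegrable_const
    ((continuous_sideDeriv2 hr hc).intervalIntegrable 0 π)
  rw [hparts, intervalIntegral.integral_const_mul, hside, sideDeriv_zero hr]
  ring

theorem integral_abs_mul_eq_integral_add {f : ℝ → ℝ} (hf : Continuous f) {a : ℝ} (ha : 0 ≤ a) :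
    ∫ s in -a..a, |s| * f s = ∫ s in 0..a, (s * f s + (a - s) * f (s - a)) := by
  have hint (b b' : ℝ) : IntervalIntegrable (fun s => |s| * f s) volume b b' :=
    (continuous_abs.mul hf).intervalIntegrable b b'
  have hpos : ∫ s in 0..a, |s| * f s = ∫ s in 0..a, s * f s := by
    refine intervalIntegral.integral_congr fun s hs => ?_
    rw [uIcc_of_le ha] at hs
    simp only [abs_of_nonneg hs.1]
  have hneg : ∫ s in -a..0, |s| * f s = ∫ s in 0..a, (a - s) * f (s - a) := by
    have hshift := intervalIntegral.integral_comp_sub_right (a := 0) (b := a)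
      (fun s => |s| * f s) a
    rw [zero_sub, sub_self] at hshift
    rw [← hshift]
    refine intervalIntegral.integral_congr fun s hs => ?_
    rw [uIcc_of_le ha] at hs
    simp only [abs_of_nonpos (sub_nonpos.2 hs.2), neg_sub]
  rw [← intervalIntegral.integral_add_adjacent_intervals (hint (-a) 0) (hint 0 a), hpos, hneg,
    add_comm, ← intervalIntegral.integral_add]
  all_goals exact Continuous.intervalIntegrable (by fun_prop) 0 a

theorem mul_sideDensity_add_antipodal (r c s : ℝ) :
    s * sideDensity r c s + (π - s) * sideDensity r c (s - π) =
      π / 2 * max (sideDeriv2 r c s) 0 - 1 / 2 * ((π - s) * sideDeriv2 r c s) +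
        (1 - cosSideMax r c) / 2 := by
  have hposPart : max (-sideDeriv2 r c s) 0 = max (sideDeriv2 r c s) 0 - sideDeriv2 r c s := by
    rw [← max_sub_sub_right, sub_self, zero_sub, max_comm]
  simp only [sideDensity, sideDeriv2_sub_pi, hposPart]
  field_simp
  ring

theorem integral_abs_mul_sideDensity {r c : ℝ} (hr : r ∈ Ioo 0 π) (hc : c ^ 2 < 1) :
    ∫ s in -π..π, |s| * sideDensity r c s = r := by
  have hposPart : IntervalIntegrable (fun s => π / 2 * max (sideDeriv2 r c s) 0) volume 0 π :=
    ((continuous_posPart_sideDeriv2 hr hc).const_mul _).intervalIntegrable 0 π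
  have hweighted : IntervalIntegrable (fun s => 1 / 2 * ((π - s) * sideDeriv2 r c s)) volume 0 π :=
    (((continuous_const.sub continuous_id).mul
      (continuous_sideDeriv2 hr hc)).const_mul _).intervalIntegrable 0 π
  rw [integral_abs_mul_eq_integral_add (continuous_sideDensity hr hc) pi_nonneg]
  simp only [mul_sideDensity_add_antipodal]
  rw [intervalIntegral.integral_add (hposPart.sub hweighted) intervalIntegrable_const,
    intervalIntegral.integral_sub hposPart hweighted, intervalIntegral.integral_const_mul,
    intervalIntegral.integral_const_mul, intervalIntegral.integral_const,
    integral_posPart_sideDeriv2_pi hr hc, integral_pi_sub_mul_sideDeriv2 hr hc, smul_eq_mul]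
  ring

theorem hasDerivAt_sideCdf {r c : ℝ} (hr : r ∈ Ioo 0 π) (hc : c ^ 2 < 1) (s : ℝ) :
    HasDerivAt (sideCdf r c) (sideDensity r c s) s :=
  (continuous_sideDensity hr hc).integral_hasStrictDerivAt 0 s |>.hasDerivAt

theorem strictMono_sideCdf {r c : ℝ} (hr : r ∈ Ioo 0 π) (hc : c ^ 2 < 1) :
    StrictMono (sideCdf r c) :=
  strictMono_of_hasDerivAt_pos (hasDerivAt_sideCdf hr hc) (sideDensity_pos hr hc)

theorem mul_le_sideCdf {r c s : ℝ} (hr : r ∈ Ioo 0 π) (hc : c ^ 2 < 1) (hs : 0 ≤ s) :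
    (1 - cosSideMax r c) / (2 * π) * s ≤ sideCdf r c s := by
  rw [sideCdf_eq_integral_posPart hr hc, le_add_iff_nonneg_left]
  exact mul_nonneg one_half_pos.le
    (intervalIntegral.integral_nonneg hs fun _ _ => le_max_right _ _)

theorem tendsto_sideCdf_atTop {r c : ℝ} (hr : r ∈ Ioo 0 π) (hc : c ^ 2 < 1) :
    Filter.Tendsto (sideCdf r c) .atTop .atTop :=
  Filter.tendsto_atTop_mono' _
    ((Filter.eventually_ge_atTop 0).mono fun _ hs => mul_le_sideCdf hr hc hs)
    (Filter.tendsto_id.const_mul_atTop (one_sub_cosSideMax_div_two_pi_pos hr hc))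

theorem surjective_sideCdf {r c : ℝ} (hr : r ∈ Ioo 0 π) (hc : c ^ 2 < 1) :
    Function.Surjective (sideCdf r c) := by
  have hcont : Continuous (sideCdf r c) :=
    continuous_iff_continuousAt.2 fun s => (hasDerivAt_sideCdf hr hc s).continuousAt
  refine hcont.surjective (tendsto_sideCdf_atTop hr hc) ?_
  have hodd : sideCdf r c = fun s => -sideCdf r (-c) (-s) := by
    funext s
    rw [sideCdf_neg_neg, neg_neg]
  rw [hodd]
  exact Filter.tendsto_neg_atTop_atBot.comp
    ((tendsto_sideCdf_atTop hr (by rwa [neg_sq])).comp Filter.tendsto_neg_atBot_atTop)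

/-- `sideCdf r c` as an increasing bijection of the line. Its inverse is the quantile function
through which the measures of all points in the direction `c` are coupled. -/
noncomputable def sideCdfIso {r c : ℝ} (hr : r ∈ Ioo 0 π) (hc : c ^ 2 < 1) : ℝ ≃o ℝ :=
  (strictMono_sideCdf hr hc).orderIsoOfSurjective _ (surjective_sideCdf hr hc)

theorem sideCdfIso_apply {r c : ℝ} (hr : r ∈ Ioo 0 π) (hc : c ^ 2 < 1) (s : ℝ) :
    sideCdfIso hr hc s = sideCdf r c s := rfl

theorem map_sideCdfIso_symm {r c : ℝ} (hr : r ∈ Ioo 0 π) (hc : c ^ 2 < 1) :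
    (volume.restrict (Ioc ((c - 1) / 2) ((1 + c) / 2))).map (sideCdfIso hr hc).symm =
      (volume.restrict (Ioc (-π) π)).withDensity fun s => ENNReal.ofReal (sideDensity r c s) := by
  rw [← sideCdf_pi hr hc, ← sideCdf_neg_pi hr hc]
  exact map_symm_volume_restrict_Ioc (sideCdfIso hr hc) (hasDerivAt_sideCdf hr hc) (-π) π

theorem sideCdfIso_symm_mem_Icc_zero_pi {r c u : ℝ} (hr : r ∈ Ioo 0 π) (hc : c ^ 2 < 1)
    (hu : u ∈ Icc 0 ((1 + c) / 2)) : (sideCdfIso hr hc).symm u ∈ Icc 0 π := by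
  rw [mem_Icc, OrderIso.le_symm_apply, OrderIso.symm_apply_le, sideCdfIso_apply, sideCdfIso_apply,
    sideCdf_zero, sideCdf_pi hr hc]
  exact hu

theorem sideCdfIso_symm_mem_Icc_neg_pi_zero {r c u : ℝ} (hr : r ∈ Ioo 0 π) (hc : c ^ 2 < 1)
    (hu : u ∈ Icc ((c - 1) / 2) 0) : (sideCdfIso hr hc).symm u ∈ Icc (-π) 0 := by
  rw [mem_Icc, OrderIso.le_symm_apply, OrderIso.symm_apply_le, sideCdfIso_apply, sideCdfIso_apply,
    sideCdf_zero, sideCdf_neg_pi hr hc]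
  exact hu

theorem sideCdfIso_symm_mono {r r' c u : ℝ} (hr : r ∈ Ioo 0 π) (hr' : r' ∈ Ioo 0 π)
    (hc : c ^ 2 < 1) (hle : r ≤ r') (hu : u ∈ Icc 0 ((1 + c) / 2)) :
    (sideCdfIso hr hc).symm u ≤ (sideCdfIso hr' hc).symm u := by
  have hmem := sideCdfIso_symm_mem_Icc_zero_pi hr' hc hu
  rw [OrderIso.symm_apply_le]
  calc u = sideCdf r' c ((sideCdfIso hr' hc).symm u) :=
        ((sideCdfIso hr' hc).apply_symm_apply u).symm
    _ ≤ sideCdf r c ((sideCdfIso hr' hc).symm u) := antitoneOn_sideCdf hc hmem hr hr' hle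

theorem sideCdfIso_symm_anti {r r' c u : ℝ} (hr : r ∈ Ioo 0 π) (hr' : r' ∈ Ioo 0 π)
    (hc : c ^ 2 < 1) (hle : r ≤ r') (hu : u ∈ Icc ((c - 1) / 2) 0) :
    (sideCdfIso hr' hc).symm u ≤ (sideCdfIso hr hc).symm u := by
  have hmem := sideCdfIso_symm_mem_Icc_neg_pi_zero hr' hc hu
  rw [OrderIso.le_symm_apply]
  calc sideCdf r c ((sideCdfIso hr' hc).symm u)
      ≤ sideCdf r' c ((sideCdfIso hr' hc).symm u) := monotoneOn_sideCdf hc hmem hr hr' hle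
    _ = u := (sideCdfIso hr' hc).apply_symm_apply u

theorem sideCdfIso_symm_mem_Icc {r c u : ℝ} (hr : r ∈ Ioo 0 π) (hc : c ^ 2 < 1)
    (hu : u ∈ Icc ((c - 1) / 2) ((1 + c) / 2)) : (sideCdfIso hr hc).symm u ∈ Icc (-π) π := by
  rw [mem_Icc, OrderIso.le_symm_apply, OrderIso.symm_apply_le, sideCdfIso_apply, sideCdfIso_apply,
    sideCdf_neg_pi hr hc, sideCdf_pi hr hc]
  exact hu

theorem sideCdfIso_symm_mem_uIcc {r r' c u : ℝ} (hr : r ∈ Ioo 0 π) (hr' : r' ∈ Ioo 0 π)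
    (hc : c ^ 2 < 1) (hle : r ≤ r') (hu : u ∈ Icc ((c - 1) / 2) ((1 + c) / 2)) :
    (sideCdfIso hr hc).symm u ∈ uIcc 0 ((sideCdfIso hr' hc).symm u) := by
  rw [mem_uIcc]
  rcases le_total 0 u with h | h
  · have hu' : u ∈ Icc 0 ((1 + c) / 2) := ⟨h, hu.2⟩
    exact .inl ⟨(sideCdfIso_symm_mem_Icc_zero_pi hr hc hu').1,
      sideCdfIso_symm_mono hr hr' hc hle hu'⟩
  · have hu' : u ∈ Icc ((c - 1) / 2) 0 := ⟨hu.1, h⟩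
    exact .inr ⟨sideCdfIso_symm_anti hr hr' hc hle hu',
      (sideCdfIso_symm_mem_Icc_neg_pi_zero hr hc hu').2⟩

/-! ### The sphere and its equator -/

namespace RoundSphere

theorem inner_val (x y : RoundSphere) : inner ℝ x.val y.val =
    x.val 0 * y.val 0 + x.val 1 * y.val 1 + x.val 2 * y.val 2 := by
  simp only [PiLp.inner_apply, Fin.sum_univ_three, RCLike.inner_apply, conj_trivial]
  ring

theorem dist_eq_arccos (x y : RoundSphere) : dist x y = arccos (inner ℝ x.val y.val) := by
  rw [dist_eq, InnerProductGeometry.angle, x.norm_val, y.norm_val, mul_one, div_one]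

theorem cos_dist (x y : RoundSphere) : cos (dist x y) = inner ℝ x.val y.val := by
  rw [dist_eq, InnerProductGeometry.cos_angle, x.norm_val, y.norm_val, mul_one, div_one]

theorem dist_le_pi (x y : RoundSphere) : dist x y ≤ π := InnerProductGeometry.angle_le_pi _ _

end RoundSphere

open RoundSphere

instance : Nonempty equator :=
  ⟨⟨⟨!₂[1, 0, 0], by simp [EuclideanSpace.norm_eq, Fin.sum_univ_three]⟩, by simp [equator]⟩⟩

theorem equator_val_two (Q : equator) : Q.1.val 2 = 0 := Q.2

theorem equator_sum_sq (Q : equator) : Q.1.val 0 ^ 2 + Q.1.val 1 ^ 2 = 1 := by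
  have h := inner_val Q.1 Q.1
  rw [real_inner_self_eq_norm_sq, Q.1.norm_val, equator_val_two] at h
  linear_combination -h

theorem equatorShift_val_zero (Q : equator) (t : ℝ) :
    (equatorShift Q t).1.val 0 = cos t * Q.1.val 0 - sin t * Q.1.val 1 := rfl

theorem equatorShift_val_one (Q : equator) (t : ℝ) :
    (equatorShift Q t).1.val 1 = sin t * Q.1.val 0 + cos t * Q.1.val 1 := rfl

theorem equator_ext {Q Q' : equator} (h0 : Q.1.val 0 = Q'.1.val 0)
    (h1 : Q.1.val 1 = Q'.1.val 1) : Q = Q' := by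
  ext i
  fin_cases i
  exacts [h0, h1, (equator_val_two Q).trans (equator_val_two Q').symm]

theorem equatorShift_zero (Q : equator) : equatorShift Q 0 = Q :=
  equator_ext (by simp [equatorShift_val_zero]) (by simp [equatorShift_val_one])

theorem equatorShift_equatorShift (Q : equator) (s t : ℝ) :
    equatorShift (equatorShift Q s) t = equatorShift Q (s + t) := by
  refine equator_ext ?_ ?_ <;>
  · simp only [equatorShift_val_zero, equatorShift_val_one, cos_add, sin_add]
    ring

theorem inner_equatorShift (P : RoundSphere) (Q : equator) (t : ℝ) :
    inner ℝ P.val (equatorShift Q t).1.val =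
      cos t * inner ℝ P.val Q.1.val + sin t * inner ℝ P.val (equatorShift Q (π / 2)).1.val := by
  simp only [inner_val, equator_val_two, equatorShift_val_zero, equatorShift_val_one,
    cos_pi_div_two, sin_pi_div_two]
  ring

/-- The inner product of the sphere in the orthonormal frame formed by `Q`, the point of the
equator orthogonal to it and the pole. -/
theorem inner_val_eq_frame (P P' : RoundSphere) (Q : equator) : inner ℝ P.val P'.val =
    inner ℝ P.val Q.1.val * inner ℝ P'.val Q.1.val +
    inner ℝ P.val (equatorShift Q (π / 2)).1.val * inner ℝ P'.val (equatorShift Q (π / 2)).1.val +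
    P.val 2 * P'.val 2 := by
  simp only [inner_val, equator_val_two, equatorShift_val_zero, equatorShift_val_one,
    cos_pi_div_two, sin_pi_div_two]
  linear_combination -(P.val 0 * P'.val 0 + P.val 1 * P'.val 1) * equator_sum_sq Q

theorem inner_equatorShift_equatorShift (Q : equator) (s t : ℝ) :
    inner ℝ (equatorShift Q s).1.val (equatorShift Q t).1.val = cos (s - t) := by
  simp only [inner_val, equator_val_two, equatorShift_val_zero, equatorShift_val_one, cos_sub]
  linear_combination (cos s * cos t + sin s * sin t) * equator_sum_sq Q

theorem dist_equatorShift_equatorShift (Q : equator) {s t : ℝ} (h : |s - t| ≤ π) :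
    dist (equatorShift Q s) (equatorShift Q t) = |s - t| := by
  rw [Subtype.dist_eq, dist_eq_arccos, inner_equatorShift_equatorShift, ← cos_abs,
    arccos_cos (abs_nonneg _) h]

theorem dist_equatorShift (Q : equator) {t : ℝ} (h : |t| ≤ π) :
    dist Q (equatorShift Q t) = |t| := by
  have hdist := dist_equatorShift_equatorShift Q (s := 0) (t := t) (by rwa [zero_sub, abs_neg])
  rwa [equatorShift_zero, zero_sub, abs_neg] at hdist

theorem dist_equatorShift_add_dist (Q : equator) {s t : ℝ} (hs : s ∈ uIcc 0 t)
    (ht : t ∈ Icc (-π) π) :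
    dist Q (equatorShift Q s) + dist (equatorShift Q s) (equatorShift Q t) =
      dist Q (equatorShift Q t) := by
  have hadd : |s| + |s - t| = |t| := by
    rcases mem_uIcc.1 hs with h | h
    · rw [abs_of_nonneg h.1, abs_of_nonpos (by linarith), abs_of_nonneg (h.1.trans h.2)]
      ring
    · rw [abs_of_nonpos h.2, abs_of_nonneg (by linarith), abs_of_nonpos (h.1.trans h.2)]
      ring
  have ht' : |t| ≤ π := abs_le.2 ht
  rw [dist_equatorShift Q ht', dist_equatorShift Q (by linarith [abs_nonneg (s - t)]),
    dist_equatorShift_equatorShift Q (by linarith [abs_nonneg s]), hadd]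

theorem lipschitzWith_equatorShift (Q : equator) : LipschitzWith 1 (equatorShift Q) := by
  refine .mk_one fun s t => ?_
  rcases le_total |s - t| π with h | h
  · exact (dist_equatorShift_equatorShift Q h).le
  · exact (dist_le_pi _ _).trans h

theorem continuous_equatorShift (Q : equator) : Continuous (equatorShift Q) :=
  (lipschitzWith_equatorShift Q).continuous

theorem measurable_equatorShift (Q : equator) : Measurable (equatorShift Q) :=
  (continuous_equatorShift Q).measurable

theorem exists_equatorShift_eq (Q Q' : equator) : ∃ t ∈ Ioc (-π) π, equatorShift Q t = Q' := by
  have hQ := equator_sum_sq Q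
  have hQ' := equator_sum_sq Q'
  set z : ℂ := ⟨Q.1.val 0 * Q'.1.val 0 + Q.1.val 1 * Q'.1.val 1,
    Q.1.val 0 * Q'.1.val 1 - Q.1.val 1 * Q'.1.val 0⟩
  have hnorm : ‖z‖ = 1 := by
    rw [Complex.norm_eq_sqrt_sq_add_sq, sqrt_eq_one]
    linear_combination (Q'.1.val 0 ^ 2 + Q'.1.val 1 ^ 2) * hQ + hQ'
  have hcos := Complex.norm_mul_cos_arg z
  have hsin := Complex.norm_mul_sin_arg z
  rw [hnorm, one_mul] at hcos hsin
  refine ⟨z.arg, Complex.arg_mem_Ioc z, equator_ext ?_ ?_⟩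
  · rw [equatorShift_val_zero, hcos, hsin]
    linear_combination Q'.1.val 0 * hQ
  · rw [equatorShift_val_one, hcos, hsin]
    linear_combination Q'.1.val 1 * hQ

theorem injOn_equatorShift (Q : equator) : InjOn (equatorShift Q) (Ioc (-π) π) := by
  intro s hs t ht h
  have hcos := inner_equatorShift_equatorShift Q s t
  rw [h, inner_equatorShift_equatorShift, sub_self, cos_zero, eq_comm,
    cos_eq_one_iff_of_lt_of_lt (by linarith [hs.1, ht.2]) (by linarith [hs.2, ht.1])] at hcos
  exact sub_eq_zero.1 hcos

theorem map_equatorShift_volume_restrict_Ioc (Q : equator) {a b : ℝ} (hab : b - a ≤ π) :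
    (volume.restrict (Ioc a b)).map (equatorShift Q) =
      (Measure.hausdorffMeasure 1).restrict (equatorShift Q '' Ioc a b) := by
  rw [← hausdorffMeasure_real]
  refine map_hausdorffMeasure_restrict (measurable_equatorShift Q) (.of_dist_eq fun x y => ?_)
    zero_le_one
  refine dist_equatorShift_equatorShift Q (abs_le.2 ⟨?_, ?_⟩) <;>
    linarith [x.2.1, x.2.2, y.2.1, y.2.2]

theorem hausdorffMeasure_equator_eq_map (Q : equator) :
    (Measure.hausdorffMeasure 1 : Measure equator) =
      (volume.restrict (Ioc (-π) π)).map (equatorShift Q) := by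
  have hpi := pi_pos
  have hunion : Ioc (-π) 0 ∪ Ioc 0 π = Ioc (-π) π :=
    Ioc_union_Ioc_eq_Ioc (neg_nonpos.2 hpi.le) hpi.le
  have hdisj : Disjoint (Ioc (-π) 0) (Ioc 0 π) := Ioc_disjoint_Ioc_of_le le_rfl
  have hinj : InjOn (equatorShift Q) (Ioc (-π) 0 ∪ Ioc 0 π) := hunion ▸ injOn_equatorShift Q
  have hmeas : MeasurableSet (equatorShift Q '' Ioc 0 π) :=
    measurableSet_Ioc.image_of_continuousOn_injOn (continuous_equatorShift Q).continuousOn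
      (hinj.mono subset_union_right)
  have himage : equatorShift Q '' Ioc (-π) π = univ :=
    eq_univ_of_forall fun Q' => exists_equatorShift_eq Q Q'
  rw [← hunion, Measure.restrict_union hdisj measurableSet_Ioc,
    Measure.map_add _ _ (measurable_equatorShift Q),
    map_equatorShift_volume_restrict_Ioc Q (by linarith),
    map_equatorShift_volume_restrict_Ioc Q (by linarith),
    ← Measure.restrict_union (hdisj.image hinj subset_union_left subset_union_right) hmeas,
    ← image_union, hunion, himage, Measure.restrict_univ]

/-- The cosine of the angle at `Q` between the great circle through `Q` and `P` and the equator. -/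
noncomputable def dirCos (P : RoundSphere) (Q : equator) : ℝ :=
  inner ℝ P.val (equatorShift Q (π / 2)).1.val / sin (dist P Q)

section OffEquator

variable {P : RoundSphere}

theorem dist_mem_Ioo (hP : P ∉ equator) (Q : equator) : dist P Q ∈ Ioo 0 π := by
  refine ⟨dist_pos.2 fun h => hP (h ▸ Q.2), (dist_le_pi P Q).lt_of_ne fun h => hP ?_⟩
  have hantipodal : inner ℝ P.val Q.1.val = -1 := by rw [← cos_dist, h, cos_pi]
  have hframe := inner_val_eq_frame P P Q
  rw [real_inner_self_eq_norm_sq, P.norm_val, hantipodal] at hframe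
  change P.val 2 = 0
  nlinarith [sq_nonneg (inner ℝ P.val (equatorShift Q (π / 2)).1.val)]

theorem dirCos_mul_sin (hP : P ∉ equator) (Q : equator) :
    dirCos P Q * sin (dist P Q) = inner ℝ P.val (equatorShift Q (π / 2)).1.val :=
  div_mul_cancel₀ _ (sin_pos_of_mem_Ioo (dist_mem_Ioo hP Q)).ne'

theorem height_sq (hP : P ∉ equator) (Q : equator) :
    P.val 2 ^ 2 = (1 - dirCos P Q ^ 2) * sin (dist P Q) ^ 2 := by
  have hframe := inner_val_eq_frame P P Q
  rw [real_inner_self_eq_norm_sq, P.norm_val, ← cos_dist, ← dirCos_mul_sin hP Q] at hframe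
  linear_combination -hframe - sin_sq_add_cos_sq (dist P Q)

theorem dirCos_sq_lt_one (hP : P ∉ equator) (Q : equator) : dirCos P Q ^ 2 < 1 := by
  have hpos : 0 < P.val 2 ^ 2 := sq_pos_of_ne_zero hP
  rw [height_sq hP Q] at hpos
  exact sub_pos.1 (pos_of_mul_pos_left hpos (sq_nonneg _))

theorem inner_equatorShift_eq_cosSide (hP : P ∉ equator) (Q : equator) (s : ℝ) :
    inner ℝ P.val (equatorShift Q s).1.val = cosSide (dist P Q) (dirCos P Q) s := by
  rw [inner_equatorShift, ← cos_dist, ← dirCos_mul_sin hP Q, cosSide]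
  ring

theorem dist_equatorShift_eq_arccos (hP : P ∉ equator) (Q : equator) (s : ℝ) :
    dist P (equatorShift Q s) = arccos (cosSide (dist P Q) (dirCos P Q) s) := by
  rw [dist_eq_arccos, inner_equatorShift_eq_cosSide hP Q]

theorem infDist_equator (hP : P ∉ equator) (Q : equator) :
    Metric.infDist P equator = arccos (cosSideMax (dist P Q) (dirCos P Q)) := by
  refine le_antisymm ?_ ((Metric.le_infDist ⟨_, Q.2⟩).2 fun Q' hQ' => ?_)
  · rw [← cosSide_sidePhase, ← dist_equatorShift_eq_arccos hP Q]
    exact Metric.infDist_le_dist_of_mem (Subtype.prop _)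
  · obtain ⟨s, -, hs⟩ := exists_equatorShift_eq Q ⟨Q', hQ'⟩
    calc arccos (cosSideMax (dist P Q) (dirCos P Q))
        ≤ arccos (cosSide (dist P Q) (dirCos P Q) s) :=
          arccos_le_arccos (cosSide_le_cosSideMax _ _ s)
      _ = dist P Q' := by rw [← dist_equatorShift_eq_arccos hP Q, hs]

theorem cosDistEquator_eq (hP : P ∉ equator) (Q : equator) :
    cosDistEquator P = cosSideMax (dist P Q) (dirCos P Q) := by
  rw [cosDistEquator, infDist_equator hP Q,
    cos_arccos (by linarith [cosSideMax_nonneg (dist P Q) (dirCos P Q)])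
      (cosSideMax_lt_one (dist_mem_Ioo hP Q) (dirCos_sq_lt_one hP Q)).le]

theorem distSecondDeriv_equatorShift (hP : P ∉ equator) (Q : equator) (s : ℝ) :
    distSecondDeriv P (equatorShift Q s) = sideDeriv2 (dist P Q) (dirCos P Q) s := by
  have hr := dist_mem_Ioo hP Q
  have hc := dirCos_sq_lt_one hP Q
  have hderiv : deriv (fun t => arccos (cosSide (dist P Q) (dirCos P Q) (s + t))) =
      fun t => sideDeriv (dist P Q) (dirCos P Q) (s + t) := funext fun t =>
    ((hasDerivAt_arccos_cosSide hr hc (s + t)).comp_const_add s t).deriv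
  simp only [distSecondDeriv, equatorShift_equatorShift, dist_equatorShift_eq_arccos hP Q]
  rw [iteratedDeriv_succ, iteratedDeriv_one, hderiv,
    ((hasDerivAt_sideDeriv hr hc (s + 0)).comp_const_add s 0).deriv, add_zero]

theorem hemisphereDensity_equatorShift (hP : P ∉ equator) (Q : equator) (s : ℝ) :
    hemisphereDensity P (equatorShift Q s) = sideDensity (dist P Q) (dirCos P Q) s := by
  rw [hemisphereDensity, sideDensity, distSecondDeriv_equatorShift hP Q, cosDistEquator_eq hP Q]

theorem measurable_hemisphereDensity (hP : P ∉ equator) : Measurable (hemisphereDensity P) := by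
  have hformula : hemisphereDensity P = fun Q : equator =>
      1 / 2 * max ((1 - cosDistEquator P ^ 2) * cos (dist P Q) /
        ((1 - cos (dist P Q) ^ 2) * √(1 - cos (dist P Q) ^ 2))) 0
      + (1 - cosDistEquator P) / (2 * π) := by
    ext Q
    rw [← equatorShift_zero Q, hemisphereDensity_equatorShift hP Q, equatorShift_zero, sideDensity,
      sideDeriv2, cosSide_zero, cosDistEquator_eq hP Q]
  have : Measurable fun Q : equator => dist P Q :=
    (continuous_const.dist continuous_subtype_val).measurable
  rw [hformula]
  fun_prop

end OffEquator

/-- `Q` is a point in which the great circle through `P` and `P'` meets the equator. -/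
theorem exists_mul_inner_equatorShift_eq (P P' : RoundSphere) : ∃ Q : equator,
    P'.val 2 * inner ℝ P.val (equatorShift Q (π / 2)).1.val =
      P.val 2 * inner ℝ P'.val (equatorShift Q (π / 2)).1.val := by
  set v := P'.val 2 • P.val - P.val 2 • P'.val with hv
  suffices h : ∃ Q : equator, inner ℝ v (equatorShift Q (π / 2)).1.val = 0 by
    simpa only [hv, inner_sub_left, real_inner_smul_left, sub_eq_zero] using h
  rcases eq_or_ne v 0 with h0 | h0
  · exact ⟨Classical.arbitrary equator, by rw [h0, inner_zero_left]⟩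
  · have hv2 : v 2 = 0 := by simp [hv, mul_comm]
    let Q : equator := ⟨⟨‖v‖⁻¹ • v, norm_smul_inv_norm h0⟩, by simp [equator, hv2]⟩
    have hQ : v = ‖v‖ • Q.1.val := (smul_inv_smul₀ (norm_ne_zero_iff.2 h0) v).symm
    have horth : inner ℝ Q.1.val (equatorShift Q (π / 2)).1.val = 0 := by
      simpa only [equatorShift_zero, zero_sub, cos_neg, cos_pi_div_two] using
        inner_equatorShift_equatorShift Q 0 (π / 2)
    exact ⟨Q, by rw [hQ, real_inner_smul_left, horth, mul_zero]⟩

section OpenHemisphere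

variable {P P' : RoundSphere}

theorem height_eq_sqrt (hP : 0 < P.val 2) (Q : equator) :
    P.val 2 = √(1 - dirCos P Q ^ 2) * sin (dist P Q) := by
  have hsin := sin_pos_of_mem_Ioo (dist_mem_Ioo (P := P) hP.ne' Q)
  rw [← sqrt_sq hP.le, height_sq hP.ne' Q, sqrt_mul' _ (sq_nonneg _), sqrt_sq hsin.le]

theorem dirCos_eq_dirCos (hP : 0 < P.val 2) (hP' : 0 < P'.val 2) {Q : equator}
    (h : P'.val 2 * inner ℝ P.val (equatorShift Q (π / 2)).1.val =
    P.val 2 * inner ℝ P'.val (equatorShift Q (π / 2)).1.val) : dirCos P Q = dirCos P' Q := by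
  have hsin := sin_pos_of_mem_Ioo (dist_mem_Ioo (P := P) hP.ne' Q)
  have hsin' := sin_pos_of_mem_Ioo (dist_mem_Ioo (P := P') hP'.ne' Q)
  have hc := sub_pos.2 (dirCos_sq_lt_one (P := P) hP.ne' Q)
  have hc' := sub_pos.2 (dirCos_sq_lt_one (P := P') hP'.ne' Q)
  rw [← dirCos_mul_sin hP.ne' Q, ← dirCos_mul_sin hP'.ne' Q, height_eq_sqrt hP Q,
    height_eq_sqrt hP' Q] at h
  have hcross : √(1 - dirCos P' Q ^ 2) * dirCos P Q = √(1 - dirCos P Q ^ 2) * dirCos P' Q := by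
    refine mul_right_cancel₀ (mul_pos hsin hsin').ne' ?_
    linear_combination h
  have hsq : dirCos P Q ^ 2 = dirCos P' Q ^ 2 := by
    have h2 := congrArg (· ^ 2) hcross
    simp only [mul_pow, sq_sqrt hc.le, sq_sqrt hc'.le] at h2
    linear_combination h2
  rw [hsq] at hcross
  exact mul_left_cancel₀ (sqrt_pos.2 hc').ne' hcross

theorem dist_eq_abs_sub_of_dirCos_eq (hP : 0 < P.val 2) (hP' : 0 < P'.val 2) {Q : equator}
    (h : dirCos P Q = dirCos P' Q) :
    dist P P' = |dist P Q - dist P' Q| := by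
  have hr := dist_mem_Ioo (P := P) hP.ne' Q
  have hr' := dist_mem_Ioo (P := P') hP'.ne' Q
  have hc := sub_pos.2 (dirCos_sq_lt_one (P := P') hP'.ne' Q)
  have hcos : cos (dist P P') = cos |dist P Q - dist P' Q| := by
    rw [cos_dist, inner_val_eq_frame P P' Q, ← cos_dist, ← cos_dist, ← dirCos_mul_sin hP.ne' Q,
      ← dirCos_mul_sin hP'.ne' Q, height_eq_sqrt hP Q, height_eq_sqrt hP' Q, h, cos_abs, cos_sub]
    linear_combination sin (dist P Q) * sin (dist P' Q) * sq_sqrt hc.le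
  refine injOn_cos ⟨dist_nonneg, dist_le_pi _ _⟩ ⟨abs_nonneg _, abs_le.2 ⟨?_, ?_⟩⟩ hcos <;>
    linarith [hr.1, hr.2, hr'.1, hr'.2]

end OpenHemisphere

/-! ### The embedding -/

/-- The measure representing a point `P` off the equator. -/
noncomputable def hemisphereMeasure (P : RoundSphere) : Measure equator :=
  (Measure.hausdorffMeasure 1).withDensity fun Q => ENNReal.ofReal (hemisphereDensity P Q)

section HemisphereMeasure

variable {P : RoundSphere}

theorem hemisphereMeasure_eq_map_withDensity (hP : P ∉ equator) (Q : equator) :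
    hemisphereMeasure P = ((volume.restrict (Ioc (-π) π)).withDensity fun s =>
      ENNReal.ofReal (sideDensity (dist P Q) (dirCos P Q) s)).map (equatorShift Q) := by
  rw [hemisphereMeasure, hausdorffMeasure_equator_eq_map Q,
    withDensity_map (measurable_equatorShift Q) (measurable_hemisphereDensity hP).ennreal_ofReal]
  simp only [hemisphereDensity_equatorShift hP Q]

theorem hemisphereMeasure_eq_map (hP : P ∉ equator) {Q : equator} {c : ℝ} (hc : c ^ 2 < 1)
    (hPQ : dirCos P Q = c) :
    hemisphereMeasure P = (volume.restrict (Ioc ((c - 1) / 2) ((1 + c) / 2))).map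
      fun u => equatorShift Q ((sideCdfIso (dist_mem_Ioo hP Q) hc).symm u) := by
  rw [hemisphereMeasure_eq_map_withDensity hP Q, hPQ, ← map_sideCdfIso_symm (dist_mem_Ioo hP Q) hc,
    Measure.map_map (measurable_equatorShift Q) (OrderIso.continuous _).measurable]
  rfl

theorem isProbabilityMeasure_hemisphereMeasure (hP : P ∉ equator) :
    IsProbabilityMeasure (hemisphereMeasure P) := by
  obtain ⟨Q⟩ := (inferInstance : Nonempty equator)
  rw [hemisphereMeasure_eq_map hP (dirCos_sq_lt_one hP Q) rfl]
  have : IsProbabilityMeasure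
      (volume.restrict (Ioc ((dirCos P Q - 1) / 2) ((1 + dirCos P Q) / 2))) := ⟨by
    rw [Measure.restrict_apply_univ, volume_Ioc, ← ENNReal.ofReal_one]
    ring_nf⟩
  exact Measure.isProbabilityMeasure_map ((measurable_equatorShift Q).comp
    (OrderIso.continuous _).measurable).aemeasurable

theorem lintegral_edist_hemisphereMeasure (hP : P ∉ equator) (Q : equator) :
    ∫⁻ x, edist Q x ∂hemisphereMeasure P = edist P Q := by
  have hr := dist_mem_Ioo hP Q
  have hc := dirCos_sq_lt_one hP Q
  have hρ := continuous_sideDensity hr hc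
  have hshift := measurable_equatorShift Q
  have hint : IntervalIntegrable (fun s => |s| * sideDensity (dist P Q) (dirCos P Q) s)
      volume (-π) π := (continuous_abs.mul hρ).intervalIntegrable _ _
  calc ∫⁻ x, edist Q x ∂hemisphereMeasure P
      = ∫⁻ s in Ioc (-π) π, ENNReal.ofReal (sideDensity (dist P Q) (dirCos P Q) s) *
          edist Q (equatorShift Q s) := by
        rw [hemisphereMeasure_eq_map_withDensity hP Q, lintegral_map (by fun_prop) hshift]
        exact lintegral_withDensity_eq_lintegral_mul _ (by fun_prop) (by fun_prop)
    _ = ∫⁻ s in Ioc (-π) π, ENNReal.ofReal (|s| * sideDensity (dist P Q) (dirCos P Q) s) := by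
        refine setLIntegral_congr_fun measurableSet_Ioc fun s hs => ?_
        rw [edist_dist, dist_equatorShift Q (abs_le.2 (Ioc_subset_Icc_self hs)),
          ENNReal.ofReal_mul (abs_nonneg s), mul_comm]
    _ = ENNReal.ofReal (∫ s in -π..π, |s| * sideDensity (dist P Q) (dirCos P Q) s) := by
        rw [intervalIntegral.integral_of_le (neg_le_self pi_nonneg),
          ofReal_integral_eq_lintegral_ofReal hint.1
            (.of_forall fun s => mul_nonneg (abs_nonneg s) (sideDensity_pos hr hc s).le)]
    _ = edist P Q := by rw [integral_abs_mul_sideDensity hr hc, edist_dist]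

end HemisphereMeasure

theorem edist_add_wassersteinDist_hemisphereMeasure {P P' : RoundSphere} (hP : P ∉ equator)
    (hP' : P' ∉ equator) {Q : equator} (hc : dirCos P Q = dirCos P' Q)
    (hle : dist P Q ≤ dist P' Q) :
    edist P Q + wassersteinDist (hemisphereMeasure P) (hemisphereMeasure P') = edist P' Q := by
  have hc1 := dirCos_sq_lt_one hP Q
  have hmeas (R : RoundSphere) (hR : R ∉ equator) :
      Measurable fun u => equatorShift Q ((sideCdfIso (dist_mem_Ioo hR Q) hc1).symm u) :=
    (measurable_equatorShift Q).comp (OrderIso.continuous _).measurable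
  rw [← lintegral_edist_hemisphereMeasure hP Q, ← lintegral_edist_hemisphereMeasure hP' Q,
    hemisphereMeasure_eq_map hP hc1 rfl, hemisphereMeasure_eq_map hP' hc1 hc.symm]
  refine lintegral_edist_add_wassersteinDist_map (hmeas P hP).aemeasurable
    (hmeas P' hP').aemeasurable Q (ae_restrict_of_forall_mem measurableSet_Ioc fun u hu => ?_)
  have hu' := Ioc_subset_Icc_self hu
  simp only [edist_dist]
  rw [← ENNReal.ofReal_add dist_nonneg dist_nonneg, dist_equatorShift_add_dist Q
    (sideCdfIso_symm_mem_uIcc (dist_mem_Ioo hP Q) (dist_mem_Ioo hP' Q) hc1 hle hu')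
    (sideCdfIso_symm_mem_Icc (dist_mem_Ioo hP' Q) hc1 hu')]

theorem wassersteinDist_hemisphereMeasure {P P' : RoundSphere} (hP : 0 < P.val 2)
    (hP' : 0 < P'.val 2) :
    wassersteinDist (hemisphereMeasure P) (hemisphereMeasure P') = edist P P' := by
  obtain ⟨Q, hQ⟩ := exists_mul_inner_equatorShift_eq P P'
  have hc := dirCos_eq_dirCos hP hP' hQ
  have hdist := dist_eq_abs_sub_of_dirCos_eq hP hP' hc
  clear hQ
  wlog hle : dist P Q ≤ dist P' Q generalizing P P'
  · rw [wassersteinDist_comm, edist_comm]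
    exact this hP' hP hc.symm (by rw [dist_comm, hdist, abs_sub_comm]) (not_le.1 hle).le
  have hadd : edist P Q + edist P P' = edist P' Q := by
    simp only [edist_dist]
    rw [← ENNReal.ofReal_add dist_nonneg dist_nonneg, hdist, abs_sub_comm,
      abs_of_nonneg (sub_nonneg.2 hle), add_sub_cancel]
  refine (ENNReal.add_right_inj (edist_ne_top P Q)).1 ?_
  rw [hadd, edist_add_wassersteinDist_hemisphereMeasure hP.ne' hP'.ne' hc hle]

open Classical in
/-- The measure representing an arbitrary point `P`, which is the Dirac measure on the equator. -/
noncomputable def closedHemisphereMeasure (P : RoundSphere) : Measure equator :=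
  if hP : P ∈ equator then Measure.dirac ⟨P, hP⟩ else hemisphereMeasure P

theorem closedHemisphereMeasure_of_mem {P : RoundSphere} (hP : P ∈ equator) :
    closedHemisphereMeasure P = Measure.dirac ⟨P, hP⟩ := dif_pos hP

theorem closedHemisphereMeasure_of_notMem {P : RoundSphere} (hP : P ∉ equator) :
    closedHemisphereMeasure P = hemisphereMeasure P := dif_neg hP

instance (P : RoundSphere) : IsProbabilityMeasure (closedHemisphereMeasure P) := by
  by_cases hP : P ∈ equator
  · rw [closedHemisphereMeasure_of_mem hP]
    infer_instance
  · rw [closedHemisphereMeasure_of_notMem hP]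
    exact isProbabilityMeasure_hemisphereMeasure hP

theorem wassersteinDist_dirac_closedHemisphereMeasure (P : RoundSphere) (Q : equator) :
    wassersteinDist (Measure.dirac Q) (closedHemisphereMeasure P) = edist Q.1 P := by
  rw [wassersteinDist_dirac_left]
  by_cases hP : P ∈ equator
  · rw [closedHemisphereMeasure_of_mem hP, lintegral_dirac' _ (by fun_prop)]
    rfl
  · rw [closedHemisphereMeasure_of_notMem hP, lintegral_edist_hemisphereMeasure hP, edist_comm]

theorem wassersteinDist_closedHemisphereMeasure {P P' : RoundSphere} (hP : P ∈ hemisphere)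
    (hP' : P' ∈ hemisphere) :
    wassersteinDist (closedHemisphereMeasure P) (closedHemisphereMeasure P') = edist P P' := by
  by_cases h : P ∈ equator
  · rw [closedHemisphereMeasure_of_mem h, wassersteinDist_dirac_closedHemisphereMeasure]
  by_cases h' : P' ∈ equator
  · rw [wassersteinDist_comm, closedHemisphereMeasure_of_mem h',
      wassersteinDist_dirac_closedHemisphereMeasure, edist_comm]
  rw [closedHemisphereMeasure_of_notMem h, closedHemisphereMeasure_of_notMem h']
  exact wassersteinDist_hemisphereMeasure (lt_of_le_of_ne hP (Ne.symm h))
    (lt_of_le_of_ne hP' (Ne.symm h'))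

/-- The embedding `ι` of the closed hemisphere into the Wasserstein space over its boundary. -/
noncomputable def hemisphereEmbedding (P : hemisphere) : WassersteinSpace equator where
  toMeasure := closedHemisphereMeasure P
  isProbabilityMeasure := inferInstance
  exists_dist_lt_top := by
    refine ⟨Classical.arbitrary equator, ?_⟩
    rw [wassersteinDist_comm, wassersteinDist_dirac_closedHemisphereMeasure]
    exact edist_lt_top _ _

theorem proposition1p5 :
    ∃ ι : hemisphere → WassersteinSpace equator,
      (∀ P P' : hemisphere,
        wassersteinDist (ι P).toMeasure (ι P').toMeasure = edist P P') ∧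
      (∀ (P : hemisphere) (hP : (P : RoundSphere) ∈ equator),
        (ι P).toMeasure = MeasureTheory.Measure.dirac (⟨(P : RoundSphere), hP⟩ : equator)) ∧
      (∀ P : hemisphere, (P : RoundSphere) ∉ equator →
        (ι P).toMeasure = (MeasureTheory.Measure.hausdorffMeasure 1 :
            MeasureTheory.Measure equator).withDensity
          (fun Q => ENNReal.ofReal (hemisphereDensity (P : RoundSphere) Q))) :=
  ⟨hemisphereEmbedding, fun P P' => wassersteinDist_closedHemisphereMeasure P.2 P'.2,
    fun _ hP => closedHemisphereMeasure_of_mem hP,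
    fun _ hP => closedHemisphereMeasure_of_notMem hP⟩
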